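/- **Setting.** Let $g>0$. A point moves in $\{(\theta,y): y\ge|\sin\theta|\}$ along the parabolas $\ddot\theta=0$, $\ddot y=-g$, and is reflected mirror-like (velocity $v\mapsto v-2\frac{v\cdot n}{n\cdot n}n$, $n=(-\cos\theta\frac{\sin\theta}{|\sin\theta|},1)$) at the boundary points $(\theta,|\sin\theta|)$, $\sin\theta\ne0$. For an energy $E$ let $\mathcal P_d$ be the set of $(\theta,\dot\theta)$ with $\sin\theta\neq0$ and $2E-2g|\sin\theta|-\dot\theta^2>0$; such a pair stands for the boundary point $(\theta,|\sin\theta|)$ with incoming velocity $\big(\dot\theta,-\sqrt{2E-2g|\sin\theta|-\dot\theta^2}\big)$. Let $f(\theta,\dot\theta)=(\theta_1,\dot\theta_1)$ be the return map, which sends the data right before a collision to the data right before the next collision, and let $\tilde f$ be the map induced by $f$ on the cylinder in which $\theta$ and $\theta+2\pi$ are identified; $\tilde{\ }$ also denotes projection of sets to this cylinder. For $k>0$ put $D_L=\{(\theta,\dot\theta)\in\mathcal P_d: |\theta-\frac{\pi}{2}|\le \frac kE,\ |\dot\theta|\le\frac{\sqrt2k}{\sqrt E}\}$, let $D_R$ be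 the same with $\frac{3\pi}{2}$ in place of $\frac\pi2$, and $\tilde D=\tilde D_L\cup\tilde D_R$. The number $k=k(E)$ is required to satisfy $$A(E,k)=\tfrac2g\,\dot\theta^a_+\sqrt{2E-2g|\sin\theta^a|-(\dot\theta^a_+)^2}+\pi=0,\qquad a=(\theta^a,\dot\theta^a)=\Big(\tfrac\pi2-\tfrac kE,\tfrac{\sqrt2k}{\sqrt E}\Big),$$ where $\dot\theta^a_+$ is the angular velocity right after the collision at $a$, and to satisfy $k_1<k<k_2$ for fixed constants $0<k_1<k_2$. Define subsets of the cylinder, as projections of subsets of the $(\theta,\dot\theta)$ plane: - $H_{R_1},H_{L_2},H_{R_3}$ are the projections of $f(D_L)\cap D_R$, $f(D_L)\cap D_L$, $f(D_L)\cap(D_R-(2\pi,0))$; - $H_{L_1},H_{R_2},H_{L_3}$ are the projections of $f(D_R)\cap(D_L+(2\pi,0))$, $f(D_R)\cap D_R$, $f(D_R)\cap D_L$; - $V_s=\tilde D\cap\tilde f^{-1}(H_s)$ for $s\in S=\{L_1,L_2,L_3,R_1,R_2,R_3\}$. Thus $H_s\subset\tilde D_L$ for $s\in\{L_1,L_2,L_3\}$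 and $H_s\subset\tilde D_R$ for $s\in\{R_1,R_2,R_3\}$. In a rectangle $[X_0,X_1]\times[Y_0,Y_1]$, a $\mu$-horizontal strip is a set $\{(X,Y): X\in[X_0,X_1],\ h_1(X)\le Y\le h_2(X)\}$, where $h_1<h_2$ are functions $[X_0,X_1]\to[Y_0,Y_1]$ with Lipschitz constant $\mu$; its width is $d=\max|h_2-h_1|$. A $\mu$-vertical strip is $\{(X,Y): Y\in[Y_0,Y_1],\ v_1(Y)\le X\le v_2(Y)\}$ with $v_1<v_2$ functions $[Y_0,Y_1]\to[X_0,X_1]$ with Lipschitz constant $\mu$, and its width is $d=\max|v_2-v_1|$. Strips in $\tilde D_L$ or $\tilde D_R$ are the projections of strips in the rectangles $|\theta-\frac\pi2|\le\frac kE$ or $|\theta-\frac{3\pi}2|\le\frac kE$, with $|\dot\theta|\le\frac{\sqrt2k}{\sqrt E}$. Say that $s$ *can precede* $j$ if $s\in\{L_1,L_2,L_3\}$ and $j\in\{R_1,L_2,R_3\}$, or $s\in\{R_1,R_2,R_3\}$ and $j\in\{L_1,R_2,L_3\}$. **Proposition 5.3.** For all $g>0$ and $0<k_1<k_2$ there are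 constants $C,E_0>0$ such that for every $E\ge E_0$ and every $k\in(k_1,k_2)$ with $A(E,k)=0$ the following holds with $\mu=C/\sqrt E$. 0. Every $H_s$ is a $\mu$-horizontal strip in that one of $\tilde D_L,\tilde D_R$ which contains it. Every $V_s$ is a $\mu$-vertical strip, in $\tilde D_L$ for $s\in\{R_1,L_2,R_3\}$ and in $\tilde D_R$ for $s\in\{L_1,R_2,L_3\}$. 1. If $s$ can precede $j$, then $\tilde f(H_s)\cap H_j$ is a $\mu$-horizontal strip (in the rectangle that contains $H_j$) and $d(\tilde f(H_s)\cap H_j)<d(H_s)$. Otherwise $\tilde f(H_s)\cap H_j=\emptyset$. 2. If $j$ can precede $s$, then $\tilde f^{-1}(V_s)\cap V_j$ is a $\mu$-vertical strip (in the rectangle that contains $V_j$) and $d(\tilde f^{-1}(V_s)\cap V_j)<d(V_s)$. Otherwise $\tilde f^{-1}(V_s)\cap V_j=\emptyset$. 3. (Conley–Moser condition CM3, with the same constant $\mu$.) If $H\subset\bigcup_sH_s$ is any $\mu$-horizontal strip in $\tilde D_L$, then for $j\in\{R_1,L_2,R_3\}$ the set $\tilde f(H)\cap H_j$ is a $\mu$-horizontal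 strip with $d(\tilde f(H)\cap H_j)<d(H)$, and for $j\in\{L_1,R_2,L_3\}$ it is empty. If $V\subset\bigcup_sV_s$ is any $\mu$-vertical strip in $\tilde D_L$, then for $j\in\{L_1,L_2,L_3\}$ the set $\tilde f^{-1}(V)\cap V_j$ is a $\mu$-vertical strip with $d(\tilde f^{-1}(V)\cap V_j)<d(V)$, and for $j\in\{R_1,R_2,R_3\}$ it is empty. The same holds with $L$ and $R$ exchanged. -/

import Mathlib

open Real Set

noncomputable section

namespace CoinBilliard

/-! ### The coin billiard

The coin (total mass `1`, length `2`, moment of inertia `1`, gravity `g`) is a mass point in the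
domain `y ≥ |sin θ|` which moves along parabolas `θ'' = 0`, `y'' = -g` and is reflected like in a
mirror at the boundary `y = |sin θ|`. -/

/-- A state `(θ, y, θ', y')` of the billiard. -/
structure State where
  angle : ℝ
  height : ℝ
  angVel : ℝ
  vertVel : ℝ

/-- The mirror reflection of the velocity at a boundary point with angle `θ`, `sin θ ≠ 0`, whose
normal vector is `(-cos θ * (sin θ / |sin θ|), 1)`. -/
def reflect (s : State) : State where
  angle := s.angle
  height := s.height
  angVel := 1 / (1 + cos s.angle ^ 2) *
    (sin s.angle ^ 2 * s.angVel +
      2 * cos s.angle * (sin s.angle / |sin s.angle|) * s.vertVel)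
  vertVel := 1 / (1 + cos s.angle ^ 2) *
    (2 * cos s.angle * (sin s.angle / |sin s.angle|) * s.angVel -
      sin s.angle ^ 2 * s.vertVel)

/-- The free (parabolic) motion during time `t`. -/
def fly (g : ℝ) (t : ℝ) (s : State) : State where
  angle := s.angle + s.angVel * t
  height := s.height + s.vertVel * t - g * t ^ 2 / 2
  angVel := s.angVel
  vertVel := s.vertVel - g * t

/-- The first positive time at which the free motion started at `s` is on the boundary. -/
def hitTime (g : ℝ) (s : State) : ℝ :=
  sInf {t : ℝ | 0 < t ∧ (fly g t s).height = |sin (fly g t s).angle|}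

/-- The return map: from the data right before a collision to the data right before the next
collision. -/
def returnMap (g : ℝ) (s : State) : State :=
  fly g (hitTime g (reflect s)) (reflect s)

/-- The points `(θ, θ')` which are the coordinates of a downward pointing collision state of
energy `E` that is not at a corner of the boundary. -/
def phaseDown (g E : ℝ) : Set (ℝ × ℝ) :=
  {p | sin p.1 ≠ 0 ∧ 0 < 2 * E - 2 * g * |sin p.1| - p.2 ^ 2}

/-- The downward pointing collision state of energy `E` with coordinates `(θ, θ')`. -/
def collisionState (g E : ℝ) (p : ℝ × ℝ) : State where
  angle := p.1
  height := |sin p.1|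
  angVel := p.2
  vertVel := -√(2 * E - 2 * g * |sin p.1| - p.2 ^ 2)

/-- The return map `f` in the coordinates `(θ, θ')`, with `θ ∈ ℝ`. -/
def f (g E : ℝ) (p : ℝ × ℝ) : ℝ × ℝ :=
  ((returnMap g (collisionState g E p)).angle, (returnMap g (collisionState g E p)).angVel)

/-! ### The cylinder -/

/-- The cylinder obtained by identifying `θ` and `θ + 2π`. -/
abbrev Cylinder : Type := Real.Angle × ℝ

/-- The projection of the `(θ, θ')` plane to the cylinder. -/
def proj (p : ℝ × ℝ) : Cylinder := ((p.1 : Real.Angle), p.2)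

/-- The map `f̃` induced by `f` on the cylinder. It is computed with the representative of the
angle in `(-π, π]`; `fTilde_proj` says that any other representative gives the same. -/
def fTilde (g E : ℝ) (q : Cylinder) : Cylinder := proj (f g E (q.1.toReal, q.2))

theorem f_add_int_mul (g E θ ω : ℝ) (n : ℤ) :
    f g E (θ + n * (2 * π), ω) = ((f g E (θ, ω)).1 + n * (2 * π), (f g E (θ, ω)).2) := by
  have h : reflect (collisionState g E (θ + n * (2 * π), ω)) =
      { reflect (collisionState g E (θ, ω)) with angle := θ + n * (2 * π) } := by
    simp [reflect, collisionState]
  have hfly : ∀ t : ℝ, fly g t { reflect (collisionState g E (θ, ω)) with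
      angle := θ + n * (2 * π) } = { fly g t (reflect (collisionState g E (θ, ω))) with
      angle := (fly g t (reflect (collisionState g E (θ, ω)))).angle + n * (2 * π) } := by
    intro t
    simp only [fly, reflect, collisionState, State.mk.injEq, and_true]
    ring
  have hT : hitTime g { reflect (collisionState g E (θ, ω)) with angle := θ + n * (2 * π) } =
      hitTime g (reflect (collisionState g E (θ, ω))) := by
    unfold hitTime
    simp only [hfly, sin_add_int_mul_two_pi]
  simp only [f, returnMap, h, hT, hfly]

theorem fTilde_proj (g E : ℝ) (p : ℝ × ℝ) : fTilde g E (proj p) = proj (f g E p) := by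
  obtain ⟨θ, ω⟩ := p
  obtain ⟨n, hn⟩ : ∃ n : ℤ, (θ : Real.Angle).toReal = θ + n * (2 * π) := by
    obtain ⟨n, hn⟩ := Real.Angle.angle_eq_iff_two_pi_dvd_sub.1
      (Real.Angle.coe_toReal (θ : Real.Angle))
    exact ⟨n, by linarith⟩
  simp only [fTilde, proj, hn, f_add_int_mul, Prod.mk.injEq, and_true]
  rw [Real.Angle.angle_eq_iff_two_pi_dvd_sub]
  exact ⟨n, by ring⟩

/-! ### The two rectangles -/

/-- The two masses of the coin. -/
inductive Side
  | L
  | R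

/-- The angle at which the mass is straight below the center of the coin. -/
def Side.center : Side → ℝ
  | .L => π / 2
  | .R => 3 * π / 2

/-- A rectangle `[X₀, X₁] × [Y₀, Y₁]`. -/
structure Rect where
  X₀ : ℝ
  X₁ : ℝ
  Y₀ : ℝ
  Y₁ : ℝ

/-- The rectangle `|θ - center| ≤ k / E`, `|θ'| ≤ √2 k / √E`. -/
def rect (E k : ℝ) (a : Side) : Rect where
  X₀ := a.center - k / E
  X₁ := a.center + k / E
  Y₀ := -(√2 * k / √E)
  Y₁ := √2 * k / √E

/-- The domains `D_L` and `D_R`. -/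
def D (g E k : ℝ) (a : Side) : Set (ℝ × ℝ) :=
  {p | p ∈ phaseDown g E ∧ |p.1 - a.center| ≤ k / E ∧ |p.2| ≤ √2 * k / √E}

/-- The union of the projections of `D_L` and `D_R` to the cylinder. -/
def DTilde (g E k : ℝ) : Set Cylinder := proj '' (D g E k .L ∪ D g E k .R)

/-- The upper left corner `a = (π/2 - k/E, √2 k / √E)` of `D_L`. -/
def corner (E k : ℝ) : ℝ × ℝ := (π / 2 - k / E, √2 * k / √E)

/-- The function `A(E, k) = (2 / g) * (θ₊' * √(2E - 2g |sin θ| - (θ₊')²)) + π`, where `θ` is the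
angle of the corner `a` and `θ₊'` is the angular velocity right after the collision at `a`. The
number `k = k(E)` is chosen such that `A(E, k) = 0`. -/
def A (g E k : ℝ) : ℝ :=
  2 / g * ((reflect (collisionState g E (corner E k))).angVel *
    √(2 * E - 2 * g * |sin (corner E k).1| -
      (reflect (collisionState g E (corner E k))).angVel ^ 2)) + π

/-! ### The six strips -/

/-- The six symbols. -/
inductive Symb
  | L1
  | L2
  | L3
  | R1
  | R2
  | R3

/-- The rectangle in which the horizontal strip `H_s` lies. -/
def Symb.side : Symb → Side
  | .L1 => .L
  | .L2 => .L
  | .L3 => .L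
  | .R1 => .R
  | .R2 => .R
  | .R3 => .R

/-- The rectangle whose image contains the horizontal strip `H_s`, which is the rectangle in which
the vertical strip `V_s` lies. -/
def Symb.source : Symb → Side
  | .R1 => .L
  | .L2 => .L
  | .R3 => .L
  | .L1 => .R
  | .R2 => .R
  | .L3 => .R

/-- The number of turns between the image of the source and the rectangle, for `θ ∈ ℝ`:
`f (D_L)` crosses `D_R`, `D_L` and `D_R - (2π, 0)`, from top to bottom, and
`f (D_R)` crosses `D_L + (2π, 0)`, `D_R` and `D_L`, from top to bottom. -/
def Symb.turns : Symb → ℤ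
  | .R1 => 0
  | .L2 => 0
  | .R3 => -1
  | .L1 => 1
  | .R2 => 0
  | .L3 => 0

/-- The set `H_s`; these six sets are the strips that make up `f̃(D̃) ∩ D̃`. -/
def H (g E k : ℝ) (s : Symb) : Set Cylinder :=
  proj '' (f g E '' D g E k s.source ∩
    {p | (p.1 - s.turns * (2 * π), p.2) ∈ D g E k s.side})

/-- The set `V_s`, the preimage of `H_s` in `D̃`. -/
def V (g E k : ℝ) (s : Symb) : Set Cylinder :=
  DTilde g E k ∩ fTilde g E ⁻¹' H g E k s

/-- The transition rule: `L1`, `L2`, `L3` can precede `R1`, `L2`, `R3`, and `R1`, `R2`, `R3` can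
precede `L1`, `R2`, `L3`. -/
def CanPrecede : Symb → Symb → Prop
  | .L1, .R1 | .L1, .L2 | .L1, .R3 => True
  | .L2, .R1 | .L2, .L2 | .L2, .R3 => True
  | .L3, .R1 | .L3, .L2 | .L3, .R3 => True
  | .R1, .L1 | .R1, .R2 | .R1, .L3 => True
  | .R2, .L1 | .R2, .R2 | .R2, .L3 => True
  | .R3, .L1 | .R3, .R2 | .R3, .L3 => True
  | _, _ => False

/-! ### Horizontal and vertical strips -/

/-- The graph of `h` is a `μ`-horizontal curve in `R`. -/
def IsHorizontalCurve (R : Rect) (μ : ℝ) (h : ℝ → ℝ) : Prop :=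
  (∀ X ∈ Icc R.X₀ R.X₁, h X ∈ Icc R.Y₀ R.Y₁) ∧
    ∀ X ∈ Icc R.X₀ R.X₁, ∀ X' ∈ Icc R.X₀ R.X₁, |h X - h X'| ≤ μ * |X - X'|

/-- The graph of `v` is a `μ`-vertical curve in `R`. -/
def IsVerticalCurve (R : Rect) (μ : ℝ) (v : ℝ → ℝ) : Prop :=
  (∀ Y ∈ Icc R.Y₀ R.Y₁, v Y ∈ Icc R.X₀ R.X₁) ∧
    ∀ Y ∈ Icc R.Y₀ R.Y₁, ∀ Y' ∈ Icc R.Y₀ R.Y₁, |v Y - v Y'| ≤ μ * |Y - Y'|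

/-- The subset `S` of the cylinder is (the projection of) a `μ`-horizontal strip in the rectangle
`R`, and its width, the maximum of `|h₂ - h₁|`, is `d`. -/
def IsHorizontalStrip (R : Rect) (μ : ℝ) (S : Set Cylinder) (d : ℝ) : Prop :=
  ∃ h₁ h₂ : ℝ → ℝ, IsHorizontalCurve R μ h₁ ∧ IsHorizontalCurve R μ h₂ ∧
    (∀ X ∈ Icc R.X₀ R.X₁, h₁ X < h₂ X) ∧
    S = proj '' {p | p.1 ∈ Icc R.X₀ R.X₁ ∧ p.2 ∈ Icc (h₁ p.1) (h₂ p.1)} ∧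
    IsGreatest ((fun X => |h₂ X - h₁ X|) '' Icc R.X₀ R.X₁) d

/-- The subset `S` of the cylinder is (the projection of) a `μ`-vertical strip in the rectangle
`R`, and its width, the maximum of `|v₂ - v₁|`, is `d`. -/
def IsVerticalStrip (R : Rect) (μ : ℝ) (S : Set Cylinder) (d : ℝ) : Prop :=
  ∃ v₁ v₂ : ℝ → ℝ, IsVerticalCurve R μ v₁ ∧ IsVerticalCurve R μ v₂ ∧
    (∀ Y ∈ Icc R.Y₀ R.Y₁, v₁ Y < v₂ Y) ∧
    S = proj '' {p | p.2 ∈ Icc R.Y₀ R.Y₁ ∧ p.1 ∈ Icc (v₁ p.2) (v₂ p.2)} ∧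
    IsGreatest ((fun Y => |v₂ Y - v₁ Y|) '' Icc R.Y₀ R.Y₁) d

end CoinBilliard

end

open CoinBilliard

noncomputable section

namespace CoinBilliard

/-! A collision in a rectangle is best described in mixed coordinates: the offset `u` of its angle
from the center of the rectangle, and the offset `x` of the next collision, where `n` half turns
separate the two centers. For large energy there is one steep parabola of energy `E` between these
two boundary points, since the square of its duration is the larger root of a quadratic equation.
Its constant angular velocity is `outVel`, and undoing the reflection at `u` gives the velocity
`inVel` before the collision. So the return map is the relation that sends `(u, inVel u x)` to `(x,
outVel u x)`, for `n = -1, 0, 1`.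

A flight lasts a time of order `√E / g` that hardly depends on its ends, so `outVel` has slopes of
order `g / √E`. The reflection near a maximum of `|sin θ|` turns the vertical speed, about `√(2E)`,
into an angular velocity proportional to the offset. Hence `inVel` decreases in `u` with slope at
least `2 * √E`, while its slope in `x` is of order `g / √E`. This is strong hyperbolicity. With
these slopes a horizontal curve contains exactly one point that lands over a given `x`, and a
vertical curve has exactly one preimage at a given height; Lipschitz constants and widths follow by
comparing slopes (`IsTwist.horizontal`, `IsTwist.vertical`).

The image must also cross the rectangles completely. The equation `A = 0` says that the flight from
the corner advances by exactly `-π`, hence ends on the left edge of a neighboring rectangle. By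
monotonicity this is the extreme case for the left edge, and mirror symmetry gives the right edge.
The delicate point is that the image does not leave the rectangle through its top or bottom: there
the margin is only of relative order `g / E` and comes from the potential energy
(`Regime.corner_outVel_le`, `Regime.neg_omega_le_outVel`). `Regime.isTwist` collects all this.

It remains to identify the relation with the return map. A flight with small angular velocity cannot
meet the boundary before its end (`hitTime_eq`), every landing in a rectangle is such a steep flight
(`Regime.outVel_eq_of_landing`), and landing data determine the number of half turns
(`Regime.turns_eq`), which yields the transition rule. -/

/-- A relation between the points `(u, P u x)` and `(x, W u x)` of the rectangle
`[-κ, κ] × [-Ω, Ω]`, given in the mixed coordinates `(u, x)`, which is strongly hyperbolic: `P` is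
steep in its first argument and all other slopes are small. -/
structure IsTwist (κ Ω a b c : ℝ) (P W : ℝ → ℝ → ℝ) : Prop where
  kappa_pos : 0 < κ
  contP : ∀ x ∈ Icc (-κ) κ, ContinuousOn (fun u => P u x) (Icc (-κ) κ)
  contW : ∀ x ∈ Icc (-κ) κ, ContinuousOn (fun u => W u x) (Icc (-κ) κ)
  steepP : ∀ x ∈ Icc (-κ) κ, ∀ u ∈ Icc (-κ) κ, ∀ u' ∈ Icc (-κ) κ, u ≤ u' →
    a * (u' - u) ≤ P u x - P u' x
  monoP : ∀ u ∈ Icc (-κ) κ, ∀ x ∈ Icc (-κ) κ, ∀ x' ∈ Icc (-κ) κ, x < x' → P u x < P u x'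
  lipP : ∀ u ∈ Icc (-κ) κ, ∀ x ∈ Icc (-κ) κ, ∀ x' ∈ Icc (-κ) κ, |P u x - P u x'| ≤ b * |x - x'|
  antiW : ∀ x ∈ Icc (-κ) κ, ∀ u ∈ Icc (-κ) κ, ∀ u' ∈ Icc (-κ) κ, u < u' → W u' x < W u x
  lipW : ∀ u ∈ Icc (-κ) κ, ∀ u' ∈ Icc (-κ) κ, ∀ x ∈ Icc (-κ) κ, ∀ x' ∈ Icc (-κ) κ,
    |W u x - W u' x'| ≤ c * (|u - u'| + |x - x'|)
  left : ∀ x ∈ Icc (-κ) κ, Ω ≤ P (-κ) x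
  right : ∀ x ∈ Icc (-κ) κ, P κ x ≤ -Ω
  mem : ∀ u ∈ Icc (-κ) κ, ∀ x ∈ Icc (-κ) κ, P u x ∈ Icc (-Ω) Ω → W u x ∈ Icc (-Ω) Ω

/-! ### Strips under a strongly hyperbolic relation -/

theorem continuousOn_of_lip {h : ℝ → ℝ} {s : Set ℝ} {μ : ℝ} (hμ : 0 ≤ μ)
    (hl : ∀ X ∈ s, ∀ X' ∈ s, |h X - h X'| ≤ μ * |X - X'|) : ContinuousOn h s := by
  have : LipschitzOnWith ⟨μ, hμ⟩ h s := by
    refine LipschitzOnWith.of_dist_le_mul fun x hx y hy => ?_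
    exact hl x hx y hy
  exact this.continuousOn

theorem exists_isGreatest_width {h₁ h₂ : ℝ → ℝ} {α β μ : ℝ} (hμ : 0 ≤ μ) (hab : α ≤ β)
    (h1 : ∀ X ∈ Icc α β, ∀ X' ∈ Icc α β, |h₁ X - h₁ X'| ≤ μ * |X - X'|)
    (h2 : ∀ X ∈ Icc α β, ∀ X' ∈ Icc α β, |h₂ X - h₂ X'| ≤ μ * |X - X'|) :
    ∃ d, IsGreatest ((fun X => |h₂ X - h₁ X|) '' Icc α β) d := by
  have hc : ContinuousOn (fun X => |h₂ X - h₁ X|) (Icc α β) :=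
    ((continuousOn_of_lip hμ h2).sub (continuousOn_of_lip hμ h1)).abs
  exact (isCompact_Icc.image_of_continuousOn hc).exists_isGreatest
    ((nonempty_Icc.2 hab).image _)

namespace IsTwist

variable {κ Ω a b c μ : ℝ} {P W : ℝ → ℝ → ℝ}

/-- For fixed `x`, `P` is at least `Ω` at the left end and at most `-Ω` at the right end, while `h`
stays between; the intermediate value theorem applies. -/
theorem exists_crossing (hT : IsTwist κ Ω a b c P W) (hμ : 0 ≤ μ)
    {h : ℝ → ℝ} (hh : IsHorizontalCurve ⟨-κ, κ, -Ω, Ω⟩ μ h) {x : ℝ} (hx : x ∈ Icc (-κ) κ) :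
    ∃ u ∈ Icc (-κ) κ, P u x = h u := by
  have hκ := hT.kappa_pos
  have hc : ContinuousOn (fun u => P u x - h u) (Icc (-κ) κ) :=
    (hT.contP x hx).sub (continuousOn_of_lip hμ hh.2)
  have hl : (-κ) ∈ Icc (-κ) κ := ⟨le_rfl, by linarith⟩
  have hr : κ ∈ Icc (-κ) κ := ⟨by linarith, le_rfl⟩
  have h0 : (0 : ℝ) ∈ Icc (P κ x - h κ) (P (-κ) x - h (-κ)) :=
    ⟨by have := hT.right x hx; have := (hh.1 κ hr).1; dsimp only at *; linarith,
     by have := hT.left x hx; have := (hh.1 (-κ) hl).2; dsimp only at *; linarith⟩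
  obtain ⟨u, hu, hu0⟩ := intermediate_value_Icc' (by linarith) hc h0
  exact ⟨u, hu, by dsimp only at hu0; linarith⟩

/-- The difference of `P` and a flat function is steep. -/
theorem steep_sub (hT : IsTwist κ Ω a b c P W)
    {h : ℝ → ℝ} (hh : IsHorizontalCurve ⟨-κ, κ, -Ω, Ω⟩ μ h) {x : ℝ} (hx : x ∈ Icc (-κ) κ)
    {u u' : ℝ} (hu : u ∈ Icc (-κ) κ) (hu' : u' ∈ Icc (-κ) κ) (huu : u ≤ u') :
    (a - μ) * (u' - u) ≤ (P u x - h u) - (P u' x - h u') := by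
  have h1 := hT.steepP x hx u hu u' hu' huu
  have h2 := (abs_le.1 (hh.2 u hu u' hu'))
  rw [abs_sub_comm u u', abs_of_nonneg (sub_nonneg.2 huu)] at h2
  nlinarith [h2.1, h2.2]

/-- The image of a horizontal strip is a thinner horizontal strip. -/
theorem horizontal (hT : IsTwist κ Ω a b c P W) (hμ : 0 ≤ μ) (hμa : μ < a)
    (hc : 0 ≤ c) (hcμ : c * (b + (a - μ)) ≤ μ * (a - μ)) (hca : c < a - μ)
    {h₁ h₂ : ℝ → ℝ} (hh₁ : IsHorizontalCurve ⟨-κ, κ, -Ω, Ω⟩ μ h₁)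
    (hh₂ : IsHorizontalCurve ⟨-κ, κ, -Ω, Ω⟩ μ h₂) (hlt : ∀ X ∈ Icc (-κ) κ, h₁ X < h₂ X)
    {d : ℝ} (hd : ∀ X ∈ Icc (-κ) κ, |h₂ X - h₁ X| ≤ d) :
    ∃ h₁' h₂' : ℝ → ℝ, IsHorizontalCurve ⟨-κ, κ, -Ω, Ω⟩ μ h₁' ∧
      IsHorizontalCurve ⟨-κ, κ, -Ω, Ω⟩ μ h₂' ∧ (∀ X ∈ Icc (-κ) κ, h₁' X < h₂' X) ∧
      (∀ x ∈ Icc (-κ) κ, ∀ y, y ∈ Icc (h₁' x) (h₂' x) ↔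
        ∃ u ∈ Icc (-κ) κ, P u x ∈ Icc (h₁ u) (h₂ u) ∧ y = W u x) ∧
      (∀ X ∈ Icc (-κ) κ, |h₂' X - h₁' X| < d) := by
  have haμ : 0 < a - μ := by linarith
  -- `U x` is the starting point on the given curve that lands over `x`, so the image curve is the
  -- graph of `x ↦ W (U x) x`.
  choose! U₁ hU₁ hE₁ using fun x (hx : x ∈ Icc (-κ) κ) => hT.exists_crossing hμ hh₁ hx
  choose! U₂ hU₂ hE₂ using fun x (hx : x ∈ Icc (-κ) κ) => hT.exists_crossing hμ hh₂ hx
  have curve : ∀ (h U : ℝ → ℝ), IsHorizontalCurve ⟨-κ, κ, -Ω, Ω⟩ μ h →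
      (∀ x ∈ Icc (-κ) κ, U x ∈ Icc (-κ) κ) → (∀ x ∈ Icc (-κ) κ, P (U x) x = h (U x)) →
      IsHorizontalCurve ⟨-κ, κ, -Ω, Ω⟩ μ (fun x => W (U x) x) := by
    intro h U hh hU hE
    refine ⟨fun x hx => hT.mem _ (hU x hx) x hx (hE x hx ▸ hh.1 _ (hU x hx)), fun x hx x' hx' => ?_⟩
    dsimp only at hx hx'
    -- At fixed `x` the difference `P - h` falls with slope at least `a - μ`, and changing `x` moves
    -- it by at most `b * |x - x'|`; this bounds the movement of its zero.
    have key : (a - μ) * |U x - U x'| ≤ b * |x - x'| := by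
      have h1 := abs_le.1 (hT.lipP _ (hU x' hx') x hx x' hx')
      have h2 := abs_le.1 (hT.lipP _ (hU x hx) x hx x' hx')
      rcases le_total (U x) (U x') with hle | hle
      · have := hT.steep_sub hh hx (hU x hx) (hU x' hx') hle
        rw [abs_sub_comm (U x), abs_of_nonneg (sub_nonneg.2 hle)]
        have e1 := hE x hx
        have e2 := hE x' hx'
        linarith [h1.1, h1.2]
      · have := hT.steep_sub hh hx (hU x' hx') (hU x hx) hle
        rw [abs_of_nonneg (sub_nonneg.2 hle)]
        have e1 := hE x hx
        have e2 := hE x' hx'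
        linarith [h1.1, h1.2]
    have h3 := hT.lipW _ (hU x hx) _ (hU x' hx') x hx x' hx'
    refine h3.trans ?_
    have h4 : (a - μ) * (c * (|U x - U x'| + |x - x'|)) ≤ (a - μ) * (μ * |x - x'|) := by
      calc (a - μ) * (c * (|U x - U x'| + |x - x'|))
          = c * ((a - μ) * |U x - U x'|) + c * (a - μ) * |x - x'| := by ring
        _ ≤ c * (b * |x - x'|) + c * (a - μ) * |x - x'| := by gcongr
        _ = c * (b + (a - μ)) * |x - x'| := by ring
        _ ≤ μ * (a - μ) * |x - x'| := by gcongr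
        _ = _ := by ring
    exact le_of_mul_le_mul_left h4 haμ
  have hlow : ∀ (h : ℝ → ℝ), IsHorizontalCurve ⟨-κ, κ, -Ω, Ω⟩ μ h → ∀ x ∈ Icc (-κ) κ,
      ∀ u ∈ Icc (-κ) κ, ∀ v ∈ Icc (-κ) κ, P v x = h v → (P u x ≤ h u ↔ v ≤ u) := by
    intro h hh x hx u hu v hv e
    constructor
    · intro h1
      by_contra! hlt'
      have := hT.steep_sub hh hx hu hv hlt'.le
      nlinarith
    · intro h1
      have := hT.steep_sub hh hx hv hu h1
      nlinarith
  have hupp : ∀ (h : ℝ → ℝ), IsHorizontalCurve ⟨-κ, κ, -Ω, Ω⟩ μ h → ∀ x ∈ Icc (-κ) κ,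
      ∀ u ∈ Icc (-κ) κ, ∀ v ∈ Icc (-κ) κ, P v x = h v → (h u ≤ P u x ↔ u ≤ v) := by
    intro h hh x hx u hu v hv e
    constructor
    · intro h1
      by_contra! hlt'
      have := hT.steep_sub hh hx hv hu hlt'.le
      nlinarith
    · intro h1
      have := hT.steep_sub hh hx hu hv h1
      nlinarith
  -- `P` decreases in `u`, so the upper curve is crossed further to the left. `W` decreases as well,
  -- which restores the order in the image.
  have hU : ∀ x ∈ Icc (-κ) κ, U₂ x < U₁ x := by
    intro x hx
    by_contra! hle
    have h1 := (hlow h₁ hh₁ x hx _ (hU₂ x hx) _ (hU₁ x hx) (hE₁ x hx)).2 hle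
    have := hlt _ (hU₂ x hx)
    rw [hE₂ x hx] at h1
    linarith
  refine ⟨fun x => W (U₁ x) x, fun x => W (U₂ x) x, curve h₁ U₁ hh₁ hU₁ hE₁,
    curve h₂ U₂ hh₂ hU₂ hE₂, fun x hx => hT.antiW x hx _ (hU₂ x hx) _ (hU₁ x hx) (hU x hx), ?_, ?_⟩
  · intro x hx y
    have hsub : Icc (U₂ x) (U₁ x) ⊆ Icc (-κ) κ := Icc_subset_Icc (hU₂ x hx).1 (hU₁ x hx).2
    constructor
    · intro hy
      obtain ⟨u, hu, hu'⟩ := intermediate_value_Icc' (hU x hx).le ((hT.contW x hx).mono hsub) hy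
      exact ⟨u, hsub hu, ⟨(hupp h₁ hh₁ x hx u (hsub hu) _ (hU₁ x hx) (hE₁ x hx)).2 hu.2,
        (hlow h₂ hh₂ x hx u (hsub hu) _ (hU₂ x hx) (hE₂ x hx)).2 hu.1⟩, hu'.symm⟩
    · rintro ⟨u, hu, hP, rfl⟩
      have h1 := (hupp h₁ hh₁ x hx u hu _ (hU₁ x hx) (hE₁ x hx)).1 hP.1
      have h2 := (hlow h₂ hh₂ x hx u hu _ (hU₂ x hx) (hE₂ x hx)).1 hP.2
      have anti : StrictAntiOn (fun u => W u x) (Icc (-κ) κ) :=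
        fun u hu u' hu' huu => hT.antiW x hx u hu u' hu' huu
      exact ⟨anti.antitoneOn hu (hU₁ x hx) h1, anti.antitoneOn (hU₂ x hx) hu h2⟩
  · intro x hx
    dsimp only
    -- At `U₂ x` the function `P - h₁` equals `h₂ - h₁ ≤ d`, and it vanishes at `U₁ x`. Hence the
    -- two crossings are at most `d / (a - μ)` apart, and `W` multiplies this by at most `c < a -
    -- μ`.
    have h1 := hT.lipW _ (hU₂ x hx) _ (hU₁ x hx) x hx x hx
    have h2 := hT.steep_sub hh₁ hx (hU₂ x hx) (hU₁ x hx) (hU x hx).le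
    have h3 := hd _ (hU₂ x hx)
    have h4 := le_abs_self (h₂ (U₂ x) - h₁ (U₂ x))
    have e1 := hE₁ x hx
    have e2 := hE₂ x hx
    have hU' := hU x hx
    rw [abs_sub_comm (U₂ x), abs_of_pos (sub_pos.2 hU'), sub_self, abs_zero, add_zero] at h1
    nlinarith

/-- The preimage of a vertical strip is a thinner vertical strip. -/
theorem vertical (hT : IsTwist κ Ω a b c P W) (hμ : 0 ≤ μ) (ha : 0 < a) (hb : 0 ≤ b)
    (hc : 0 ≤ c) (hμc : 4 * (μ * c) ≤ 1) (hba : 2 * b * (μ * c) + 2 * b < a)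
    (haμ : 1 ≤ μ * (a - 2 * b * (μ * c)))
    {v₁ v₂ : ℝ → ℝ} (hv₁ : IsVerticalCurve ⟨-κ, κ, -Ω, Ω⟩ μ v₁)
    (hv₂ : IsVerticalCurve ⟨-κ, κ, -Ω, Ω⟩ μ v₂) (hlt : ∀ Y ∈ Icc (-Ω) Ω, v₁ Y < v₂ Y)
    {d : ℝ} (hd : ∀ Y ∈ Icc (-Ω) Ω, |v₂ Y - v₁ Y| ≤ d) :
    ∃ v₁' v₂' : ℝ → ℝ, IsVerticalCurve ⟨-κ, κ, -Ω, Ω⟩ μ v₁' ∧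
      IsVerticalCurve ⟨-κ, κ, -Ω, Ω⟩ μ v₂' ∧ (∀ Y ∈ Icc (-Ω) Ω, v₁' Y < v₂' Y) ∧
      (∀ y ∈ Icc (-Ω) Ω, ∀ u, u ∈ Icc (v₁' y) (v₂' y) ↔
        u ∈ Icc (-κ) κ ∧ ∃ x ∈ Icc (-κ) κ, x ∈ Icc (v₁ (W u x)) (v₂ (W u x)) ∧ y = P u x) ∧
      (∀ Y ∈ Icc (-Ω) Ω, |v₂' Y - v₁' Y| < d) := by
  have hκ := hT.kappa_pos
  have hconst : ∀ y ∈ Icc (-Ω) Ω, IsHorizontalCurve ⟨-κ, κ, -Ω, Ω⟩ 0 (fun _ => y) :=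
    fun y hy => ⟨fun _ _ => hy, fun _ _ _ _ => by simp⟩
  -- `U y x` is the starting point at height `y` that lands over `x`: the crossing with a constant
  -- curve, for which the Lipschitz constant `0` is available.
  choose! U hU hE using fun y (hy : y ∈ Icc (-Ω) Ω) x (hx : x ∈ Icc (-κ) κ) =>
    hT.exists_crossing le_rfl (hconst y hy) hx
  -- uniqueness and monotonicity of `U y`
  have inj : ∀ x ∈ Icc (-κ) κ, ∀ u ∈ Icc (-κ) κ, ∀ u' ∈ Icc (-κ) κ, P u x = P u' x → u = u' := by
    intro x hx u hu u' hu' e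
    rcases lt_trichotomy u u' with h | h | h
    · have := hT.steepP x hx u hu u' hu' h.le
      nlinarith
    · exact h
    · have := hT.steepP x hx u' hu' u hu h.le
      nlinarith
  have absP : ∀ x ∈ Icc (-κ) κ, ∀ u ∈ Icc (-κ) κ, ∀ u' ∈ Icc (-κ) κ,
      a * |u - u'| ≤ |P u x - P u' x| := by
    intro x hx u hu u' hu'
    rcases le_total u u' with h | h
    · rw [abs_sub_comm u, abs_of_nonneg (sub_nonneg.2 h)]
      exact (hT.steepP x hx u hu u' hu' h).trans (le_abs_self _)
    · rw [abs_of_nonneg (sub_nonneg.2 h), abs_sub_comm (P u x)]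
      exact (hT.steepP x hx u' hu' u hu h).trans (le_abs_self _)
  have hUmono : ∀ y ∈ Icc (-Ω) Ω, StrictMonoOn (U y) (Icc (-κ) κ) := by
    intro y hy x hx x' hx' hxx
    by_contra! hle
    have h1 := hT.steepP x' hx' _ (hU y hy x' hx') _ (hU y hy x hx) hle
    have h2 := hT.monoP _ (hU y hy x hx) x hx x' hx' hxx
    rw [hE y hy x hx] at h2
    rw [hE y hy x' hx'] at h1
    nlinarith
  have hUlip : ∀ y ∈ Icc (-Ω) Ω, ∀ x ∈ Icc (-κ) κ, ∀ x' ∈ Icc (-κ) κ,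
      a * |U y x - U y x'| ≤ b * |x - x'| := by
    intro y hy x hx x' hx'
    refine (absP x hx _ (hU y hy x hx) _ (hU y hy x' hx')).trans ?_
    have := hT.lipP _ (hU y hy x' hx') x' hx' x hx
    rw [hE y hy x' hx', abs_sub_comm x'] at this
    rwa [hE y hy x hx]
  have hba1 : b ≤ a := by nlinarith [mul_nonneg hb (mul_nonneg hμ hc)]
  have hUlip1 : ∀ y ∈ Icc (-Ω) Ω, ∀ x ∈ Icc (-κ) κ, ∀ x' ∈ Icc (-κ) κ,
      |U y x - U y x'| ≤ 1 * |x - x'| := by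
    intro y hy x hx x' hx'
    have h1 := hUlip y hy x hx x' hx'
    have h2 : a * |U y x - U y x'| ≤ a * (1 * |x - x'|) := by
      rw [one_mul]; exact h1.trans (by gcongr)
    exact le_of_mul_le_mul_left h2 ha
  have hUcont : ∀ y ∈ Icc (-Ω) Ω, ContinuousOn (U y) (Icc (-κ) κ) :=
    fun y hy => continuousOn_of_lip zero_le_one (hUlip1 y hy)
  have hWmem : ∀ y ∈ Icc (-Ω) Ω, ∀ x ∈ Icc (-κ) κ, W (U y x) x ∈ Icc (-Ω) Ω :=
    fun y hy x hx => hT.mem _ (hU y hy x hx) x hx (by rw [hE y hy x hx]; exact hy)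
  have hWlip : ∀ y ∈ Icc (-Ω) Ω, ∀ x ∈ Icc (-κ) κ, ∀ x' ∈ Icc (-κ) κ,
      |W (U y x) x - W (U y x') x'| ≤ 2 * c * |x - x'| := by
    intro y hy x hx x' hx'
    refine (hT.lipW _ (hU y hy x hx) _ (hU y hy x' hx') x hx x' hx').trans ?_
    have := hUlip1 y hy x hx x' hx'
    nlinarith
  have hvW : ∀ v, IsVerticalCurve ⟨-κ, κ, -Ω, Ω⟩ μ v → ∀ y ∈ Icc (-Ω) Ω,
      ∀ x ∈ Icc (-κ) κ, ∀ x' ∈ Icc (-κ) κ,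
      |v (W (U y x) x) - v (W (U y x') x')| ≤ (2 * (μ * c)) * |x - x'| := by
    intro v hv y hy x hx x' hx'
    refine (hv.2 _ (hWmem y hy x hx) _ (hWmem y hy x' hx')).trans ?_
    calc μ * |W (U y x) x - W (U y x') x'| ≤ μ * (2 * c * |x - x'|) := by
          gcongr; exact hWlip y hy x hx x' hx'
      _ = _ := by ring
  have hl : (-κ) ∈ Icc (-κ) κ := ⟨le_rfl, by linarith⟩
  have hr : κ ∈ Icc (-κ) κ := ⟨by linarith, le_rfl⟩
  -- the function `x - v (W (U y x) x)` is increasing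
  have steep : ∀ v, IsVerticalCurve ⟨-κ, κ, -Ω, Ω⟩ μ v → ∀ y ∈ Icc (-Ω) Ω,
      ∀ x ∈ Icc (-κ) κ, ∀ x' ∈ Icc (-κ) κ, x ≤ x' →
      (x' - x) ≤ 2 * ((x' - v (W (U y x') x')) - (x - v (W (U y x) x))) := by
    intro v hv y hy x hx x' hx' hxx
    have h1 := abs_le.1 (hvW v hv y hy x' hx' x hx)
    rw [abs_of_nonneg (sub_nonneg.2 hxx)] at h1
    nlinarith [h1.1, h1.2]
  -- A point at height `y` is mapped onto the curve `v` exactly when its landing place `x` is a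
  -- fixed point of `x ↦ v (W (U y x) x)`. This map has Lipschitz constant at most `1 / 2`.
  have cross : ∀ v, IsVerticalCurve ⟨-κ, κ, -Ω, Ω⟩ μ v → ∀ y ∈ Icc (-Ω) Ω,
      ∃ z ∈ Icc (-κ) κ, z = v (W (U y z) z) := by
    intro v hv y hy
    have hcont : ContinuousOn (fun x => x - v (W (U y x) x)) (Icc (-κ) κ) :=
      continuousOn_id.sub (continuousOn_of_lip (by positivity) (hvW v hv y hy))
    have h0 : (0 : ℝ) ∈ Icc (-κ - v (W (U y (-κ)) (-κ))) (κ - v (W (U y κ) κ)) :=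
      ⟨by have := (hv.1 _ (hWmem y hy _ hl)).1; dsimp only at this; linarith,
       by have := (hv.1 _ (hWmem y hy _ hr)).2; dsimp only at this; linarith⟩
    obtain ⟨z, hz, hz0⟩ := intermediate_value_Icc (by linarith) hcont h0
    exact ⟨z, hz, by dsimp only at hz0; linarith⟩
  choose! Z₁ hZ₁ hF₁ using cross v₁ hv₁
  choose! Z₂ hZ₂ hF₂ using cross v₂ hv₂
  have curve : ∀ (v Z : ℝ → ℝ), IsVerticalCurve ⟨-κ, κ, -Ω, Ω⟩ μ v →
      (∀ y ∈ Icc (-Ω) Ω, Z y ∈ Icc (-κ) κ) →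
      (∀ y ∈ Icc (-Ω) Ω, Z y = v (W (U y (Z y)) (Z y))) →
      IsVerticalCurve ⟨-κ, κ, -Ω, Ω⟩ μ (fun y => U y (Z y)) := by
    intro v Z hv hZ hF
    refine ⟨fun y hy => hU y hy _ (hZ y hy), fun y hy y' hy' => ?_⟩
    dsimp only at hy hy' ⊢
    have hu := hU y hy _ (hZ y hy)
    have hu' := hU y' hy' _ (hZ y' hy')
    have h1 : |Z y - Z y'| ≤ μ * (c * (|U y (Z y) - U y' (Z y')| + |Z y - Z y'|)) := by
      have h2 := hv.2 _ (hWmem y hy _ (hZ y hy)) _ (hWmem y' hy' _ (hZ y' hy'))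
      rw [← hF y hy, ← hF y' hy'] at h2
      exact h2.trans (by gcongr; exact hT.lipW _ hu _ hu' _ (hZ y hy) _ (hZ y' hy'))
    -- As `μ * c ≤ 1 / 4`, the term with `|Z y - Z y'|` on the right of `h1` can be absorbed on the
    -- left.
    have h2 : |Z y - Z y'| ≤ 2 * (μ * c) * |U y (Z y) - U y' (Z y')| := by
      have := abs_nonneg (Z y - Z y')
      have := abs_nonneg (U y (Z y) - U y' (Z y'))
      nlinarith
    have h3 := absP _ (hZ y hy) _ hu _ hu'
    have h4 := hT.lipP _ hu' _ (hZ y' hy') _ (hZ y hy)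
    have h5 : |P (U y (Z y)) (Z y) - P (U y' (Z y')) (Z y)| ≤
        |y - y'| + |P (U y' (Z y')) (Z y') - P (U y' (Z y')) (Z y)| := by
      rw [hE y hy _ (hZ y hy), hE y' hy' _ (hZ y' hy')]
      calc _ = |(y - y') + (y' - P (U y' (Z y')) (Z y))| := by ring_nf
        _ ≤ _ := abs_add_le _ _
    rw [abs_sub_comm (Z y')] at h4
    have h6 : (a - 2 * b * (μ * c)) * |U y (Z y) - U y' (Z y')| ≤ |y - y'| := by
      nlinarith [mul_le_mul_of_nonneg_left h2 hb]
    have h7 : 0 < a - 2 * b * (μ * c) := by linarith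
    have h8 : (a - 2 * b * (μ * c)) * |U y (Z y) - U y' (Z y')| ≤
        (a - 2 * b * (μ * c)) * (μ * |y - y'|) := by
      refine h6.trans ?_
      have := abs_nonneg (y - y')
      nlinarith
    exact le_of_mul_le_mul_left h8 h7
  have hZ : ∀ y ∈ Icc (-Ω) Ω, Z₁ y < Z₂ y := by
    intro y hy
    by_contra! hle
    have h1 := steep v₁ hv₁ y hy _ (hZ₂ y hy) _ (hZ₁ y hy) hle
    have h2 := hlt _ (hWmem y hy _ (hZ₂ y hy))
    have e1 := hF₁ y hy
    have e2 := hF₂ y hy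
    linarith
  refine ⟨fun y => U y (Z₁ y), fun y => U y (Z₂ y), curve v₁ Z₁ hv₁ hZ₁ hF₁,
    curve v₂ Z₂ hv₂ hZ₂ hF₂, fun y hy => hUmono y hy (hZ₁ y hy) (hZ₂ y hy) (hZ y hy), ?_, ?_⟩
  · intro y hy u
    have hsub : Icc (Z₁ y) (Z₂ y) ⊆ Icc (-κ) κ := Icc_subset_Icc (hZ₁ y hy).1 (hZ₂ y hy).2
    constructor
    · intro hu
      obtain ⟨x, hx, rfl⟩ := intermediate_value_Icc (hZ y hy).le ((hUcont y hy).mono hsub) hu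
      refine ⟨hU y hy x (hsub hx), x, hsub hx, ⟨?_, ?_⟩, (hE y hy x (hsub hx)).symm⟩
      · have := steep v₁ hv₁ y hy _ (hZ₁ y hy) _ (hsub hx) hx.1
        have := hF₁ y hy
        have := hx.1
        linarith
      · have := steep v₂ hv₂ y hy _ (hsub hx) _ (hZ₂ y hy) hx.2
        have := hF₂ y hy
        have := hx.2
        linarith
    · rintro ⟨hu, x, hx, hxv, e⟩
      obtain rfl : u = U y x := inj x hx u hu _ (hU y hy x hx) (by rw [hE y hy x hx, e])
      have h1 : Z₁ y ≤ x := by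
        by_contra! hlt'
        have := steep v₁ hv₁ y hy _ hx _ (hZ₁ y hy) hlt'.le
        have := hF₁ y hy
        have := hxv.1
        linarith
      have h2 : x ≤ Z₂ y := by
        by_contra! hlt'
        have := steep v₂ hv₂ y hy _ (hZ₂ y hy) _ hx hlt'.le
        have := hF₂ y hy
        have := hxv.2
        linarith
      exact ⟨(hUmono y hy).monotoneOn (hZ₁ y hy) hx h1, (hUmono y hy).monotoneOn hx (hZ₂ y hy) h2⟩
  · intro y hy
    dsimp only
    have h1 := hUlip y hy _ (hZ₂ y hy) _ (hZ₁ y hy)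
    have h2 := steep v₁ hv₁ y hy _ (hZ₁ y hy) _ (hZ₂ y hy) (hZ y hy).le
    have h3 := hd _ (hWmem y hy _ (hZ₂ y hy))
    have h4 := le_abs_self (v₂ (W (U y (Z₂ y)) (Z₂ y)) - v₁ (W (U y (Z₂ y)) (Z₂ y)))
    have e1 := hF₁ y hy
    have e2 := hF₂ y hy
    have h5 := hZ y hy
    rw [abs_of_pos (sub_pos.2 h5)] at h1
    -- The landing places may be up to `2 * d` apart, but `U y` contracts by `b / a < 1 / 2`.
    have h6 : Z₂ y - Z₁ y ≤ 2 * d := by linarith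
    have h7 : 0 < d := by linarith
    have h8 : 2 * b < a := by nlinarith [mul_nonneg hb (mul_nonneg hμ hc)]
    have h9 : a * |U y (Z₂ y) - U y (Z₁ y)| < a * d := by nlinarith
    exact lt_of_mul_lt_mul_left h9 ha.le

end IsTwist

/-! ### Reflection and flight in mixed coordinates -/

/-- The energy `E` is large. -/
structure Regime (g E k : ℝ) : Prop where
  hg : 0 < g
  hk : 0 < k
  big : 10000 * ((1 + g) ^ 2 * (1 + k) ^ 2) ≤ E
  -- This makes `(k / E) ^ 2` small against `g / E`, the relative size of the margin at the corner.
  big' : 10000 * k ^ 2 ≤ g * E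

/-- The vertical speed at the height `cos u`, if the angular velocity is `w`. -/
def vertSpeed (g E u w : ℝ) : ℝ := √(2 * E - 2 * g * cos u - w ^ 2)

/-- The angular velocity right before a collision at the angle `u` from the center, if that right
after the collision is `w`. -/
def backVel (g E u w : ℝ) : ℝ :=
  (cos u ^ 2 * w - 2 * sin u * vertSpeed g E u w) / (1 + sin u ^ 2)

/-- The vertical speed right before a collision at the angle `u` from the center, if the angular
velocity right after the collision is `w`. -/
def backVert (g E u w : ℝ) : ℝ :=
  (2 * sin u * w + cos u ^ 2 * vertSpeed g E u w) / (1 + sin u ^ 2)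

/-- The energy at the mean height of the two ends of a flight. -/
def meanEnergy (g E u x : ℝ) : ℝ := 2 * E - g * (cos u + cos x)

/-- The discriminant of the quadratic equation for the square of the time of flight. -/
def disc (g E n u x : ℝ) : ℝ :=
  meanEnergy g E u x ^ 2 - g ^ 2 * ((n * π + x - u) ^ 2 + (cos x - cos u) ^ 2)

/-- `g` times the duration of the flight from the angle `u` to the angle `n * π + x`. -/
def gTime (g E n u x : ℝ) : ℝ := √(2 * (meanEnergy g E u x + √(disc g E n u x)))

/-- The angular velocity of the flight from the angle `u` to the angle `n * π + x`. -/
def outVel (g E n u x : ℝ) : ℝ := g * (n * π + x - u) / gTime g E n u x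

/-- The angular velocity right before the collision that leads to the flight from the angle `u` to
the angle `n * π + x`. -/
def inVel (g E n u x : ℝ) : ℝ := backVel g E u (outVel g E n u x)

/-! ### Symmetry -/

theorem vertSpeed_neg (g E u w : ℝ) : vertSpeed g E (-u) w = vertSpeed g E u w := by
  simp [vertSpeed]

theorem vertSpeed_neg_right (g E u w : ℝ) : vertSpeed g E u (-w) = vertSpeed g E u w := by
  simp [vertSpeed]

theorem backVel_neg_neg (g E u w : ℝ) : backVel g E (-u) (-w) = -backVel g E u w := by
  simp only [backVel, vertSpeed_neg, vertSpeed_neg_right, cos_neg, sin_neg]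
  ring

theorem gTime_neg (g E n u x : ℝ) : gTime g E (-n) (-u) (-x) = gTime g E n u x := by
  simp only [gTime, disc, meanEnergy, cos_neg]
  ring_nf

theorem outVel_neg (g E n u x : ℝ) : outVel g E (-n) (-u) (-x) = -outVel g E n u x := by
  simp only [outVel, gTime_neg]
  ring

/-- The mirror symmetry about the center of a mass exchanges `n` and `-n`; it reduces the case `n =
1` and the right edge to `n = -1` and the left edge. -/
theorem inVel_neg (g E n u x : ℝ) : inVel g E (-n) (-u) (-x) = -inVel g E n u x := by
  simp only [inVel, outVel_neg, backVel_neg_neg]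

/-! ### The reflection is an involution -/

/-- A mirror reflection preserves the length of the velocity. -/
theorem backVel_sq_add (g E u w : ℝ) :
    backVel g E u w ^ 2 + backVert g E u w ^ 2 = w ^ 2 + vertSpeed g E u w ^ 2 := by
  have h : (1 + sin u ^ 2) ≠ 0 := by positivity
  simp only [backVel, backVert, cos_sq']
  field_simp
  ring

theorem vertSpeed_backVel {g E u w : ℝ} (h : 0 ≤ 2 * E - 2 * g * cos u - w ^ 2)
    (hv : 0 ≤ backVert g E u w) : vertSpeed g E u (backVel g E u w) = backVert g E u w := by
  have h1 := backVel_sq_add g E u w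
  have h2 : vertSpeed g E u w ^ 2 = 2 * E - 2 * g * cos u - w ^ 2 := sq_sqrt h
  rw [vertSpeed, ← sqrt_sq hv]
  congr 1
  linarith

/-- Reversing the signs of `u` exchanges the reflection with its inverse. The sign condition on
`backVert` is needed because the vertical speed is recovered as a nonnegative root. -/
theorem backVel_neg_backVel {g E u w : ℝ} (h : 0 ≤ 2 * E - 2 * g * cos u - w ^ 2)
    (hv : 0 ≤ backVert g E u w) : backVel g E (-u) (backVel g E u w) = w := by
  have h1 := vertSpeed_backVel h hv
  have h0 : (1 + sin u ^ 2) ≠ 0 := by positivity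
  rw [backVel, vertSpeed_neg, h1, backVel, backVert, sin_neg, cos_neg]
  simp only [cos_sq']
  field_simp
  ring

/-! ### The flight -/

/-- Eliminating the velocities from the equations of flight leaves `τ ^ 4 / 4 - M * τ ^ 2 + g ^ 2 *
(δ ^ 2 + h ^ 2) = 0` for `τ = g * t`, where `M` is `meanEnergy`, `δ` the advance and `h` the rise.
With launch and landing speeds `a` and `b`, the discriminant is `(a * b - w ^ 2) ^ 2`, so the
condition `w ^ 2 ≤ a * b` selects the larger root: the steep flight. -/
theorem gTime_eq {g E n u x w t : ℝ} (hg : 0 < g) (hu : 0 < vertSpeed g E u w)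
    (hx : 0 < vertSpeed g E x w) (hw : w ^ 2 ≤ vertSpeed g E u w * vertSpeed g E x w)
    (ht : g * t = vertSpeed g E u w + vertSpeed g E x w) (hδ : w * t = n * π + x - u) :
    gTime g E n u x = g * t ∧ outVel g E n u x = w := by
  have hu2 : vertSpeed g E u w ^ 2 = 2 * E - 2 * g * cos u - w ^ 2 :=
    sq_sqrt (sqrt_pos.1 hu).le
  have hx2 : vertSpeed g E x w ^ 2 = 2 * E - 2 * g * cos x - w ^ 2 :=
    sq_sqrt (sqrt_pos.1 hx).le
  set a := vertSpeed g E u w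
  set b := vertSpeed g E x w
  have h1 : disc g E n u x = (a * b - w ^ 2) ^ 2 := by
    have e1 : meanEnergy g E u x = (a ^ 2 + b ^ 2) / 2 + w ^ 2 := by
      rw [meanEnergy]; linarith
    have e2 : g * (cos x - cos u) = (a ^ 2 - b ^ 2) / 2 := by linarith
    have e3 : disc g E n u x = meanEnergy g E u x ^ 2 - (w * (g * t)) ^ 2
        - (g * (cos x - cos u)) ^ 2 := by
      rw [disc, ← hδ]; ring
    rw [e3, e1, e2, ht]
    ring
  have h2 : gTime g E n u x = g * t := by
    rw [gTime, h1, sqrt_sq (by linarith), ht, ← sqrt_sq (by positivity : 0 ≤ a + b), meanEnergy]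
    congr 1
    linarith
  refine ⟨h2, ?_⟩
  have h3 : 0 < g * t := by rw [ht]; positivity
  rw [outVel, h2, ← hδ]
  have h4 : t ≠ 0 := (pos_of_mul_pos_right h3 hg.le).ne'
  field_simp

/-! ### Trigonometric estimates -/

theorem abs_cos_sub_cos_le {κ u u' : ℝ} (hu : |u| ≤ κ) (hu' : |u'| ≤ κ) :
    |cos u - cos u'| ≤ κ * |u - u'| := by
  rw [cos_sub_cos, abs_mul, abs_mul, abs_neg, abs_two]
  have h1 := abs_sin_le_abs (x := (u + u') / 2)
  have h2 := abs_sin_le_abs (x := (u - u') / 2)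
  rw [abs_div, abs_two] at h1 h2
  have h3 := abs_add_le u u'
  have h4 := abs_nonneg (sin ((u - u') / 2))
  have h5 := abs_nonneg (sin ((u + u') / 2))
  nlinarith

theorem abs_sin_sub_sin_le (u u' : ℝ) : |sin u - sin u'| ≤ |u - u'| := by
  rw [sin_sub_sin, abs_mul, abs_mul, abs_two]
  have h2 := abs_sin_le_abs (x := (u - u') / 2)
  rw [abs_div, abs_two] at h2
  have h3 := abs_cos_le_one ((u + u') / 2)
  have h4 := abs_nonneg (sin ((u - u') / 2))
  nlinarith

theorem one_sub_le_cos {κ u : ℝ} (hu : |u| ≤ κ) : 1 - κ ^ 2 / 2 ≤ cos u := by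
  have h := one_sub_sq_div_two_le_cos (x := u)
  have : u ^ 2 ≤ κ ^ 2 := by rw [← sq_abs]; gcongr
  linarith

theorem le_sin_sub_sin {κ u u' : ℝ} (hκ : κ ≤ 1 / 10) (hu : |u| ≤ κ) (hu' : |u'| ≤ κ)
    (h : u ≤ u') : 0.99 * (u' - u) ≤ sin u' - sin u := by
  rcases h.eq_or_lt with rfl | h
  · simp
  have hd : 0 < (u' - u) / 2 := by linarith
  have hb := abs_le.1 hu
  have hb' := abs_le.1 hu'
  have h1 := sin_gt_sub_cube hd
  have h2 : 1 - κ ^ 2 / 2 ≤ cos ((u' + u) / 2) :=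
    one_sub_le_cos (abs_le.2 ⟨by linarith, by linarith⟩)
  have hκ0 : 0 ≤ κ := (abs_nonneg _).trans hu
  rw [sin_sub_sin]
  have h3 : κ ^ 2 ≤ 1 / 100 := by nlinarith
  have h4 : ((u' - u) / 2) ^ 2 ≤ 1 / 100 := by nlinarith
  have h5 : 0.9975 * ((u' - u) / 2) ≤ sin ((u' - u) / 2) := by nlinarith
  have h6 : 0.995 ≤ cos ((u' + u) / 2) := by norm_num at h3 ⊢; linarith
  nlinarith

/-! ### Estimates for large energy -/

namespace Regime

variable {g E k : ℝ}

theorem E_ge (R : Regime g E k) : 10000 ≤ E := by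
  have := R.big; have := R.hg; have := R.hk
  have h1 : 1 ≤ (1 + g) ^ 2 := by nlinarith
  have h2 : 1 ≤ (1 + k) ^ 2 := by nlinarith
  nlinarith

theorem g_sq_le (R : Regime g E k) : 10000 * g ^ 2 ≤ E := by
  have := R.big; have := R.hg; have := R.hk
  have h1 : g ^ 2 ≤ (1 + g) ^ 2 := by nlinarith
  have h2 : 1 ≤ (1 + k) ^ 2 := by nlinarith
  nlinarith

theorem g_le (R : Regime g E k) : 10000 * g ≤ E := by
  have := R.big; have := R.hg; have := R.hk
  have h1 : g ≤ (1 + g) ^ 2 := by nlinarith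
  have h2 : 1 ≤ (1 + k) ^ 2 := by nlinarith
  nlinarith

theorem k_sq_le (R : Regime g E k) : 10000 * k ^ 2 ≤ E := by
  have := R.big; have := R.hg; have := R.hk
  have h1 : k ^ 2 ≤ (1 + k) ^ 2 := by nlinarith
  have h2 : 1 ≤ (1 + g) ^ 2 := by nlinarith
  nlinarith

theorem k_le (R : Regime g E k) : 10000 * k ≤ E := by
  have := R.big; have := R.hg; have := R.hk
  have h1 : k ≤ (1 + k) ^ 2 := by nlinarith
  have h2 : 1 ≤ (1 + g) ^ 2 := by nlinarith
  nlinarith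

theorem g_mul_k_le (R : Regime g E k) : 10000 * (g * k) ≤ E := by
  have := R.big; have := R.hg; have := R.hk
  have h1 : k ≤ (1 + k) ^ 2 := by nlinarith
  have h2 : g ≤ (1 + g) ^ 2 := by nlinarith
  have h3 : g * k ≤ (1 + g) ^ 2 * (1 + k) ^ 2 := by gcongr
  nlinarith

theorem E_pos (R : Regime g E k) : 0 < E := by linarith [R.E_ge]

theorem sqrt_pos' (R : Regime g E k) : 0 < √E := sqrt_pos.2 R.E_pos

theorem sq_sqrt' (R : Regime g E k) : √E ^ 2 = E := sq_sqrt R.E_pos.le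

theorem sqrt_ge (R : Regime g E k) : 100 ≤ √E := by
  apply le_sqrt_of_sq_le
  linarith [R.E_ge]

theorem kappa_pos (R : Regime g E k) : 0 < k / E := div_pos R.hk R.E_pos

theorem kappa_le (R : Regime g E k) : k / E ≤ 1 / 10000 := by
  rw [div_le_div_iff₀ R.E_pos (by norm_num)]
  linarith [R.k_le]

theorem kappa_mul (R : Regime g E k) : k / E * E = k := div_mul_cancel₀ _ R.E_pos.ne'

theorem omega_eq (R : Regime g E k) : √2 * k / √E = √2 * (k / E * √E) := by
  have := R.sqrt_pos'
  have h := R.sq_sqrt'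
  have := R.E_pos
  field_simp
  rw [h]

theorem omega_pos (R : Regime g E k) : 0 < √2 * k / √E := by
  have := R.sqrt_pos'; have := R.hk; positivity

theorem g_le_sqrt (R : Regime g E k) : 100 * g ≤ √E := by
  apply le_sqrt_of_sq_le
  linarith [R.g_sq_le]

theorem k_le_sqrt (R : Regime g E k) : 100 * k ≤ √E := by
  apply le_sqrt_of_sq_le
  linarith [R.k_sq_le]

theorem omega_le (R : Regime g E k) : √2 * k / √E ≤ 1 / 50 := by
  have h2 : √2 ≤ 2 := by rw [sqrt_le_left] <;> norm_num
  have := R.hk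
  rw [div_le_iff₀ R.sqrt_pos']
  nlinarith [R.k_le_sqrt]

theorem vertSpeed_sq (R : Regime g E k) {u w : ℝ} (hw : |w| ≤ 1) :
    vertSpeed g E u w ^ 2 = 2 * E - 2 * g * cos u - w ^ 2 := by
  have : w ^ 2 ≤ 1 := by rw [← sq_abs]; nlinarith [abs_nonneg w]
  refine sq_sqrt ?_
  nlinarith [R.g_le, R.E_ge, cos_le_one u, R.hg]

theorem vertSpeed_ge (R : Regime g E k) {u w : ℝ} (hw : |w| ≤ 1) : 1.41 * √E ≤ vertSpeed g E u w := by
  have : w ^ 2 ≤ 1 := by rw [← sq_abs]; nlinarith [abs_nonneg w]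
  apply le_sqrt_of_sq_le
  rw [mul_pow, R.sq_sqrt']
  nlinarith [R.g_le, R.E_ge, cos_le_one u, R.hg]

theorem vertSpeed_pos (R : Regime g E k) {u w : ℝ} (hw : |w| ≤ 1) : 0 < vertSpeed g E u w :=
  lt_of_lt_of_le (by have := R.sqrt_pos'; positivity) (R.vertSpeed_ge hw)

theorem cos_ge (R : Regime g E k) {u : ℝ} (hu : |u| ≤ k / E) : 0.99 ≤ cos u := by
  have := one_sub_le_cos hu
  have := R.kappa_le
  have := R.kappa_pos
  norm_num at *
  nlinarith

theorem vertSpeed_le (R : Regime g E k) {u w : ℝ} (hu : |u| ≤ k / E) : vertSpeed g E u w ≤ √2 * √E := by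
  rw [← sqrt_mul (by norm_num)]
  apply sqrt_le_sqrt
  nlinarith [R.cos_ge hu, R.hg, sq_nonneg w]

theorem abs_vertSpeed_sub_le_right (R : Regime g E k) {u w w' : ℝ} (hw : |w| ≤ 1 / 10) (hw' : |w'| ≤ 1 / 10) :
    |vertSpeed g E u w - vertSpeed g E u w'| ≤ |w - w'| / 1000 := by
  have h1 := R.vertSpeed_sq (u := u) (w := w) (by linarith)
  have h2 := R.vertSpeed_sq (u := u) (w := w') (by linarith)
  have h3 := R.vertSpeed_ge (u := u) (w := w) (by linarith)
  have h4 := R.vertSpeed_ge (u := u) (w := w') (by linarith)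
  have h5 := R.sqrt_ge
  have h6 : (vertSpeed g E u w - vertSpeed g E u w') * (vertSpeed g E u w + vertSpeed g E u w')
      = -((w - w') * (w + w')) := by nlinarith
  have h7 : |vertSpeed g E u w - vertSpeed g E u w'| *
      (vertSpeed g E u w + vertSpeed g E u w') = |w - w'| * |w + w'| := by
    rw [← abs_of_pos (show 0 < vertSpeed g E u w + vertSpeed g E u w' by linarith), ← abs_mul, h6,
      abs_neg, abs_mul]
  have h8 := abs_add_le w w'
  have h9 := abs_nonneg (w - w')
  have h10 := abs_nonneg (vertSpeed g E u w - vertSpeed g E u w')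
  nlinarith

theorem abs_vertSpeed_sub_le_left (R : Regime g E k) {u u' w : ℝ} (hu : |u| ≤ k / E) (hu' : |u'| ≤ k / E)
    (hw : |w| ≤ 1) :
    |vertSpeed g E u w - vertSpeed g E u' w| ≤ |u - u'| / 1000 := by
  have h1 := R.vertSpeed_sq (u := u) (w := w) hw
  have h2 := R.vertSpeed_sq (u := u') (w := w) hw
  have h3 := R.vertSpeed_ge (u := u) (w := w) hw
  have h4 := R.vertSpeed_ge (u := u') (w := w) hw
  have h5 := R.sqrt_ge
  have h6 : (vertSpeed g E u w - vertSpeed g E u' w) * (vertSpeed g E u w + vertSpeed g E u' w)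
      = -(2 * g * (cos u - cos u')) := by nlinarith
  have h7 : |vertSpeed g E u w - vertSpeed g E u' w| *
      (vertSpeed g E u w + vertSpeed g E u' w) = 2 * g * |cos u - cos u'| := by
    rw [← abs_of_pos (show 0 < vertSpeed g E u w + vertSpeed g E u' w by linarith), ← abs_mul, h6,
      abs_neg, abs_mul, abs_of_pos (by linarith [R.hg])]
  have h8 := abs_cos_sub_cos_le hu hu'
  have h9 := abs_nonneg (u - u')
  have h10 := abs_nonneg (vertSpeed g E u w - vertSpeed g E u' w)
  have h11 : g * (k / E) ≤ 1 / 10000 := by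
    rw [← mul_div_assoc, div_le_div_iff₀ R.E_pos (by norm_num)]
    linarith [R.g_mul_k_le]
  have h12 : 2 * g * |cos u - cos u'| ≤ 2 / 10000 * |u - u'| := by
    calc _ ≤ 2 * g * (k / E * |u - u'|) := by have := R.hg; gcongr
      _ = 2 * (g * (k / E)) * |u - u'| := by ring
      _ ≤ 2 * (1 / 10000) * |u - u'| := by gcongr
      _ = _ := by ring
  nlinarith

theorem abs_sin_le (R : Regime g E k) {u : ℝ} (hu : |u| ≤ k / E) : |sin u| ≤ 1 / 10000 :=
  abs_sin_le_abs.trans (hu.trans R.kappa_le)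

/-- `backVel` is increasing in `w`, with a derivative that is close to `1`. -/
theorem backVel_sub_right (R : Regime g E k) {u w w' : ℝ} (hu : |u| ≤ k / E) (hw : |w| ≤ 1 / 10)
    (hw' : |w'| ≤ 1 / 10) (h : w ≤ w') :
    0.9 * (w' - w) ≤ backVel g E u w' - backVel g E u w ∧
      backVel g E u w' - backVel g E u w ≤ 1.1 * (w' - w) := by
  have h1 := R.abs_vertSpeed_sub_le_right (u := u) hw' hw
  rw [abs_of_nonneg (sub_nonneg.2 h)] at h1
  have h2 := abs_le.1 h1
  have h3 := abs_le.1 (R.abs_sin_le hu)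
  have h4 := R.cos_ge hu
  have h5 := cos_le_one u
  have h6 : sin u ^ 2 ≤ 1 / 10000 := by nlinarith
  have e : backVel g E u w' - backVel g E u w = (cos u ^ 2 * (w' - w) - 2 * sin u *
      (vertSpeed g E u w' - vertSpeed g E u w)) / (1 + sin u ^ 2) := by
    simp only [backVel]; ring
  have h7 : |2 * sin u * (vertSpeed g E u w' - vertSpeed g E u w)| ≤ 0.01 * (w' - w) := by
    rw [abs_mul, abs_mul, abs_two]
    have := R.abs_sin_le hu
    have := abs_nonneg (sin u)
    have : 0 ≤ w' - w := by linarith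
    calc _ ≤ 2 * (1 / 10000) * ((w' - w) / 1000) := by gcongr
      _ ≤ _ := by norm_num; linarith
  have h8 := abs_le.1 h7
  have h9 : cos u ^ 2 = 1 - sin u ^ 2 := cos_sq' u
  have h10 : 0 < 1 + sin u ^ 2 := by positivity
  have h11 : 0 ≤ w' - w := by linarith
  rw [e, le_div_iff₀ h10, div_le_iff₀ h10, h9]
  constructor <;> nlinarith [mul_nonneg (sq_nonneg (sin u)) h11,
    mul_le_mul_of_nonneg_right h6 h11]

/-- `backVel` is steeply decreasing in `u`. -/
theorem backVel_sub_left (R : Regime g E k) {u u' w : ℝ} (hu : |u| ≤ k / E) (hu' : |u'| ≤ k / E)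
    (hw : |w| ≤ 1 / 10) (h : u ≤ u') :
    2.5 * √E * (u' - u) ≤ backVel g E u w - backVel g E u' w := by
  have hd : 0 ≤ u' - u := by linarith
  have h1 := R.abs_vertSpeed_sub_le_left hu' hu (w := w) (by linarith)
  rw [abs_of_nonneg hd] at h1
  have h3 := R.abs_sin_le hu
  have h3' := R.abs_sin_le hu'
  have hs := le_sin_sub_sin (R.kappa_le.trans (by norm_num)) hu hu' h
  have hs' := abs_sin_sub_sin_le u' u
  have hs0 : 0 ≤ sin u' - sin u := by norm_num at hs; linarith
  rw [abs_of_nonneg hd, abs_of_nonneg hs0] at hs'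
  have hS := R.vertSpeed_ge (u := u') (w := w) (by linarith)
  have hr := R.sqrt_ge
  -- The middle term, the change of `2 * sin u / (1 + sin u ^ 2)` times the vertical speed, has
  -- slope at least `1.9 * 1.41 * √E`. The other two are each at most `0.01 * (u' - u)`.
  have e : backVel g E u w - backVel g E u' w =
      2 * ((sin u' - sin u) * (sin u' + sin u)) / ((1 + sin u ^ 2) * (1 + sin u' ^ 2)) * w +
      2 * ((sin u' - sin u) * (1 - sin u * sin u')) / ((1 + sin u ^ 2) * (1 + sin u' ^ 2)) *
        vertSpeed g E u' w +
      2 * sin u / (1 + sin u ^ 2) * (vertSpeed g E u' w - vertSpeed g E u w) := by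
    simp only [backVel, cos_sq']
    have : 1 + sin u ^ 2 ≠ 0 := by positivity
    have : 1 + sin u' ^ 2 ≠ 0 := by positivity
    field_simp
    ring
  rw [e]
  generalize vertSpeed g E u' w = S' at *
  generalize vertSpeed g E u w = S at *
  generalize sin u = s at *
  generalize sin u' = s' at *
  have hD : 1 ≤ (1 + s ^ 2) * (1 + s' ^ 2) := by
    nlinarith [sq_nonneg s, sq_nonneg s', mul_nonneg (sq_nonneg s) (sq_nonneg s')]
  have hs2 : s ^ 2 ≤ 1 / 10000 := by rw [← sq_abs]; nlinarith [abs_nonneg s]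
  have hs2' : s' ^ 2 ≤ 1 / 10000 := by rw [← sq_abs]; nlinarith [abs_nonneg s']
  have hD' : (1 + s ^ 2) * (1 + s' ^ 2) ≤ 1.001 := by
    nlinarith [mul_le_mul hs2 hs2' (sq_nonneg s') (by norm_num)]
  generalize (1 + s ^ 2) * (1 + s' ^ 2) = D at *
  have t1 : |2 * ((s' - s) * (s' + s)) / D * w| ≤ 0.01 * (u' - u) := by
    have a1 : |s' + s| ≤ 1 / 5000 := (abs_add_le _ _).trans (by linarith)
    have a2 : |2 * ((s' - s) * (s' + s)) / D| ≤ 2 * ((u' - u) * (1 / 5000)) := by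
      rw [abs_div, abs_mul, abs_mul, abs_two, abs_of_nonneg hs0, abs_of_pos (by linarith : 0 < D)]
      refine (div_le_self (by positivity) hD).trans ?_
      gcongr
    rw [abs_mul]
    calc _ ≤ 2 * ((u' - u) * (1 / 5000)) * (1 / 10) := by gcongr
      _ ≤ _ := by norm_num; linarith
  have t3 : |2 * s / (1 + s ^ 2) * (S' - S)| ≤ 0.01 * (u' - u) := by
    have a2 : |2 * s / (1 + s ^ 2)| ≤ 2 * (1 / 10000) := by
      rw [abs_div, abs_mul, abs_two, abs_of_pos (by positivity : 0 < 1 + s ^ 2)]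
      refine (div_le_self (by positivity) (by nlinarith [sq_nonneg s])).trans ?_
      gcongr
    rw [abs_mul]
    calc _ ≤ 2 * (1 / 10000) * ((u' - u) / 1000) := by gcongr
      _ ≤ _ := by norm_num; linarith
  have t2 : 1.9 * (u' - u) ≤ 2 * ((s' - s) * (1 - s * s')) / D := by
    have a1 : s * s' ≤ 1 / 10000 := by nlinarith [sq_nonneg (s - s')]
    rw [le_div_iff₀ (by linarith)]
    have a2 : 1.9 * (u' - u) * D ≤ 1.9 * (u' - u) * 1.001 := by gcongr
    have a3 : (s' - s) * (1 - 1 / 10000) ≤ (s' - s) * (1 - s * s') := by gcongr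
    linarith
  have t2' : 1.9 * (u' - u) * (1.41 * √E) ≤ 2 * ((s' - s) * (1 - s * s')) / D * S' := by
    have : 0 ≤ u' - u := hd
    gcongr
    exact le_trans (by positivity) t2
  have := (abs_le.1 t1).1
  have := (abs_le.1 t3).1
  have : 100 * (u' - u) ≤ √E * (u' - u) := by gcongr
  nlinarith

end Regime

/-! ### Dependence of the flight on its ends -/

namespace Regime

variable {g E k n : ℝ}

theorem abs_advance_le (R : Regime g E k) (hn : |n| ≤ 1) {u x : ℝ} (hu : |u| ≤ k / E)
    (hx : |x| ≤ k / E) : |n * π + x - u| ≤ 4 := by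
  have h1 : |n * π| ≤ 3.15 := by
    rw [abs_mul, abs_of_pos pi_pos]
    nlinarith [pi_lt_d2, pi_pos, abs_nonneg n]
  have := R.kappa_le
  have h2 := abs_le.1 h1
  have h3 := abs_le.1 hu
  have h4 := abs_le.1 hx
  norm_num at h2
  rw [abs_le]
  constructor <;> linarith

theorem meanEnergy_ge (R : Regime g E k) {u x : ℝ} : 1.99 * E ≤ meanEnergy g E u x := by
  rw [meanEnergy]
  nlinarith [cos_le_one u, cos_le_one x, R.hg, R.g_le]

theorem meanEnergy_le (R : Regime g E k) {u x : ℝ} (hu : |u| ≤ k / E) (hx : |x| ≤ k / E) :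
    meanEnergy g E u x ≤ 2 * E := by
  rw [meanEnergy]
  nlinarith [R.cos_ge hu, R.cos_ge hx, R.hg]

theorem abs_rise_le (R : Regime g E k) {u x : ℝ} (hu : |u| ≤ k / E) (hx : |x| ≤ k / E) :
    |cos x - cos u| ≤ 1 := by
  have := R.cos_ge hu
  have := R.cos_ge hx
  have := cos_le_one u
  have := cos_le_one x
  rw [abs_le]
  constructor <;> linarith

theorem disc_ge (R : Regime g E k) (hn : |n| ≤ 1) {u x : ℝ} (hu : |u| ≤ k / E)
    (hx : |x| ≤ k / E) : (1.9 * E) ^ 2 ≤ disc g E n u x := by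
  have h1 := R.meanEnergy_ge (u := u) (x := x)
  have h2 : (n * π + x - u) ^ 2 ≤ 16 := by
    rw [← sq_abs]; nlinarith [R.abs_advance_le hn hu hx, abs_nonneg (n * π + x - u)]
  have h3 : (cos x - cos u) ^ 2 ≤ 1 := by
    rw [← sq_abs]; nlinarith [R.abs_rise_le hu hx, abs_nonneg (cos x - cos u)]
  have h4 : g ^ 2 * ((n * π + x - u) ^ 2 + (cos x - cos u) ^ 2) ≤ E / 10000 * 17 := by
    have := R.g_sq_le
    have := R.E_pos
    gcongr <;> linarith
  rw [disc]
  nlinarith [R.E_ge]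

theorem sqrt_disc_ge (R : Regime g E k) (hn : |n| ≤ 1) {u x : ℝ} (hu : |u| ≤ k / E)
    (hx : |x| ≤ k / E) : 1.9 * E ≤ √(disc g E n u x) :=
  le_sqrt_of_sq_le (R.disc_ge hn hu hx)

theorem gTime_sq (R : Regime g E k) (hn : |n| ≤ 1) {u x : ℝ} (hu : |u| ≤ k / E)
    (hx : |x| ≤ k / E) :
    gTime g E n u x ^ 2 = 2 * (meanEnergy g E u x + √(disc g E n u x)) := by
  refine sq_sqrt ?_
  have := R.meanEnergy_ge (u := u) (x := x)
  have := R.sqrt_disc_ge hn hu hx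
  have := R.E_pos
  norm_num at *
  linarith

theorem gTime_ge (R : Regime g E k) (hn : |n| ≤ 1) {u x : ℝ} (hu : |u| ≤ k / E)
    (hx : |x| ≤ k / E) : 2.7 * √E ≤ gTime g E n u x := by
  apply le_sqrt_of_sq_le
  have := R.meanEnergy_ge (u := u) (x := x)
  have := R.sqrt_disc_ge hn hu hx
  have := R.E_pos
  rw [mul_pow, R.sq_sqrt']
  norm_num at *
  linarith

theorem gTime_pos (R : Regime g E k) (hn : |n| ≤ 1) {u x : ℝ} (hu : |u| ≤ k / E)
    (hx : |x| ≤ k / E) : 0 < gTime g E n u x :=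
  lt_of_lt_of_le (by have := R.sqrt_pos'; positivity) (R.gTime_ge hn hu hx)

theorem abs_outVel_le (R : Regime g E k) (hn : |n| ≤ 1) {u x : ℝ} (hu : |u| ≤ k / E)
    (hx : |x| ≤ k / E) : |outVel g E n u x| ≤ 1 / 50 := by
  have h1 := R.gTime_ge hn hu hx
  have h2 := R.abs_advance_le hn hu hx
  have h3 := R.g_le_sqrt
  have h4 := R.sqrt_pos'
  have h5 := R.gTime_pos hn hu hx
  have h6 := R.hg
  rw [outVel, abs_div, abs_mul, abs_of_pos h5, abs_of_pos h6, div_le_iff₀ h5]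
  have : g * |n * π + x - u| ≤ g * 4 := by gcongr
  norm_num at *
  linarith

/-- The heights vary little because `cos` has slope at most `k / E` on the rectangle, and the
advance enters the discriminant only with the factor `g ^ 2`, small against its size `E ^ 2`. The
bound is scaled with `√E`, like the flight time to which it is compared. -/
theorem abs_gTime_sub_le (R : Regime g E k) (hn : |n| ≤ 1) {u x u' x' : ℝ} (hu : |u| ≤ k / E)
    (hx : |x| ≤ k / E) (hu' : |u'| ≤ k / E) (hx' : |x'| ≤ k / E) :
    |gTime g E n u x - gTime g E n u' x'| ≤ √E * (|u - u'| + |x - x'|) / 1000 := by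
  have hE := R.E_pos
  have hE4 := R.E_ge
  have hg := R.hg
  have hr := R.sqrt_ge
  have hrr := R.sq_sqrt'
  have c1 := abs_cos_sub_cos_le hu hu'
  have c2 := abs_cos_sub_cos_le hx hx'
  have hκ := R.kappa_pos
  have hκ1 := R.kappa_le
  have d1 := abs_nonneg (u - u')
  have d2 := abs_nonneg (x - x')
  set D := |u - u'| + |x - x'| with hD
  have hD0 : 0 ≤ D := by positivity
  have hgκ : g * (k / E) ≤ 1 / 10000 := by
    rw [← mul_div_assoc, div_le_div_iff₀ hE (by norm_num)]
    linarith [R.g_mul_k_le]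
  have hM : |meanEnergy g E u x - meanEnergy g E u' x'| ≤ D / 10000 := by
    have e : meanEnergy g E u x - meanEnergy g E u' x' =
        -(g * ((cos u - cos u') + (cos x - cos x'))) := by
      simp only [meanEnergy]; ring
    rw [e, abs_neg, abs_mul, abs_of_pos hg]
    calc g * |(cos u - cos u') + (cos x - cos x')|
        ≤ g * (k / E * |u - u'| + k / E * |x - x'|) := by
          gcongr; exact (abs_add_le _ _).trans (add_le_add c1 c2)
      _ = g * (k / E) * D := by rw [hD]; ring
      _ ≤ 1 / 10000 * D := by gcongr
      _ = _ := by ring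
  have hM2 : |meanEnergy g E u x ^ 2 - meanEnergy g E u' x' ^ 2| ≤ E * D / 1000 := by
    have e : meanEnergy g E u x ^ 2 - meanEnergy g E u' x' ^ 2 =
      (meanEnergy g E u x - meanEnergy g E u' x') * (meanEnergy g E u x + meanEnergy g E u' x') := by
      ring
    have m1 := R.meanEnergy_le hu hx
    have m2 := R.meanEnergy_le hu' hx'
    have m3 := R.meanEnergy_ge (u := u) (x := x)
    have m4 := R.meanEnergy_ge (u := u') (x := x')
    norm_num at m3 m4
    rw [e, abs_mul, abs_of_pos (show 0 < meanEnergy g E u x + meanEnergy g E u' x' by linarith)]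
    have m5 : meanEnergy g E u x + meanEnergy g E u' x' ≤ 4 * E := by linarith
    have m6 : 0 ≤ meanEnergy g E u x + meanEnergy g E u' x' := by linarith
    calc _ ≤ D / 10000 * (4 * E) := by gcongr
      _ ≤ _ := by nlinarith [mul_nonneg hE.le hD0]
  have hδ : |(n * π + x - u) ^ 2 - (n * π + x' - u') ^ 2| ≤ 8 * D := by
    have e : (n * π + x - u) ^ 2 - (n * π + x' - u') ^ 2 =
      ((x - x') - (u - u')) * ((n * π + x - u) + (n * π + x' - u')) := by ring
    rw [e, abs_mul, mul_comm 8]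
    have a1 := abs_add_le (n * π + x - u) (n * π + x' - u')
    have a2 := abs_sub (x - x') (u - u')
    gcongr
    · linarith
    · linarith [R.abs_advance_le hn hu hx, R.abs_advance_le hn hu' hx']
  have hh : |(cos x - cos u) ^ 2 - (cos x' - cos u') ^ 2| ≤ D := by
    have e : (cos x - cos u) ^ 2 - (cos x' - cos u') ^ 2 =
      ((cos x - cos x') - (cos u - cos u')) * ((cos x - cos u) + (cos x' - cos u')) := by ring
    rw [e, abs_mul]
    have a1 := abs_add_le (cos x - cos u) (cos x' - cos u')
    have a2 := abs_sub (cos x - cos x') (cos u - cos u')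
    have a3 := R.abs_rise_le hu hx
    have a4 := R.abs_rise_le hu' hx'
    have a5 : k / E * |u - u'| + k / E * |x - x'| ≤ 1 / 10000 * D := by
      rw [hD, mul_add]; gcongr
    calc _ ≤ (1 / 10000 * D) * 2 := by gcongr <;> linarith
      _ ≤ _ := by linarith
  have hdisc : |disc g E n u x - disc g E n u' x'| ≤ E * D / 400 := by
    have e : disc g E n u x - disc g E n u' x' =
        (meanEnergy g E u x ^ 2 - meanEnergy g E u' x' ^ 2) -
        g ^ 2 * (((n * π + x - u) ^ 2 - (n * π + x' - u') ^ 2) +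
          ((cos x - cos u) ^ 2 - (cos x' - cos u') ^ 2)) := by
      simp only [disc]; ring
    rw [e]
    refine (abs_sub _ _).trans ?_
    rw [abs_mul, abs_of_nonneg (sq_nonneg g)]
    have a1 := abs_add_le ((n * π + x - u) ^ 2 - (n * π + x' - u') ^ 2)
      ((cos x - cos u) ^ 2 - (cos x' - cos u') ^ 2)
    have a2 : g ^ 2 * |((n * π + x - u) ^ 2 - (n * π + x' - u') ^ 2) +
          ((cos x - cos u) ^ 2 - (cos x' - cos u') ^ 2)| ≤ E / 10000 * (9 * D) := by
      gcongr
      · linarith [R.g_sq_le]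
      · linarith
    nlinarith [mul_nonneg hE.le hD0]
  have hN : |√(disc g E n u x) - √(disc g E n u' x')| ≤ D / 400 := by
    have n1 := R.sqrt_disc_ge hn hu hx
    have n2 := R.sqrt_disc_ge hn hu' hx'
    have s1 := sq_sqrt (le_trans (by positivity) (R.disc_ge hn hu hx))
    have s2 := sq_sqrt (le_trans (by positivity) (R.disc_ge hn hu' hx'))
    norm_num at n1 n2
    have e : disc g E n u x - disc g E n u' x' =
      (√(disc g E n u x) - √(disc g E n u' x')) * (√(disc g E n u x) + √(disc g E n u' x')) := by
      linear_combination s2 - s1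
    rw [e, abs_mul,
      abs_of_pos (show 0 < √(disc g E n u x) + √(disc g E n u' x') by linarith)] at hdisc
    have a1 : |√(disc g E n u x) - √(disc g E n u' x')| * E ≤ D / 400 * E := by
      refine le_trans ?_ (hdisc.trans (by linarith))
      gcongr
      linarith
    exact le_of_mul_le_mul_right a1 hE
  have t1 := R.gTime_ge hn hu hx
  have t2 := R.gTime_ge hn hu' hx'
  have q1 := R.gTime_sq hn hu hx
  have q2 := R.gTime_sq hn hu' hx'
  have e : (gTime g E n u x - gTime g E n u' x') * (gTime g E n u x + gTime g E n u' x') =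
      2 * ((meanEnergy g E u x - meanEnergy g E u' x') +
        (√(disc g E n u x) - √(disc g E n u' x'))) := by linear_combination q1 - q2
  have e' := congrArg abs e
  norm_num at t1 t2
  rw [abs_mul, abs_mul, abs_two,
    abs_of_pos (show 0 < gTime g E n u x + gTime g E n u' x' by linarith)] at e'
  have a1 := abs_add_le (meanEnergy g E u x - meanEnergy g E u' x')
        (√(disc g E n u x) - √(disc g E n u' x'))
  have a2 := abs_nonneg (gTime g E n u x - gTime g E n u' x')
  have a3 : |gTime g E n u x - gTime g E n u' x'| * 540 ≤
      |gTime g E n u x - gTime g E n u' x'| * (gTime g E n u x + gTime g E n u' x') := by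
    gcongr; linarith
  have a4 : 100 * D ≤ √E * D := by gcongr
  linarith

/-- `outVel * gTime` is `g` times the advance, and `gTime` is almost constant. So differences of
`outVel` follow those of `x - u` up to one percent, which yields both monotonicities and the
Lipschitz bound. -/
theorem outVel_sub (R : Regime g E k) (hn : |n| ≤ 1) {u x u' x' : ℝ} (hu : |u| ≤ k / E)
    (hx : |x| ≤ k / E) (hu' : |u'| ≤ k / E) (hx' : |x'| ≤ k / E) :
    |(outVel g E n u x - outVel g E n u' x') * gTime g E n u x - g * ((x - x') - (u - u'))| ≤
      g * (|u - u'| + |x - x'|) / 100 := by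
  have h1 := R.gTime_pos hn hu hx
  have h2 := R.gTime_pos hn hu' hx'
  have e : (outVel g E n u x - outVel g E n u' x') * gTime g E n u x - g * ((x - x') - (u - u')) =
      -(outVel g E n u' x' * (gTime g E n u x - gTime g E n u' x')) := by
    simp only [outVel]
    field_simp
    ring
  have h3 := R.gTime_ge hn hu' hx'
  have h4 := R.abs_gTime_sub_le hn hu hx hu' hx'
  have h5 := R.abs_advance_le hn hu' hx'
  have h6 := R.sqrt_pos'
  have hg := R.hg
  rw [e, abs_neg, abs_mul, outVel, abs_div, abs_mul, abs_of_pos hg, abs_of_pos h2]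
  have h7 : g * |n * π + x' - u'| / gTime g E n u' x' ≤ g * 4 / (2.7 * √E) := by gcongr
  have hD0 : 0 ≤ |u - u'| + |x - x'| := by positivity
  calc _ ≤ g * 4 / (2.7 * √E) * (√E * (|u - u'| + |x - x'|) / 1000) := by gcongr
    _ = g * (|u - u'| + |x - x'|) * (4 / 2.7 / 1000) := by field_simp
    _ ≤ g * (|u - u'| + |x - x'|) * (1 / 100) := by
      apply mul_le_mul_of_nonneg_left (by norm_num) (by positivity)
    _ = _ := by ring

theorem abs_outVel_sub_le (R : Regime g E k) (hn : |n| ≤ 1) {u x u' x' : ℝ} (hu : |u| ≤ k / E)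
    (hx : |x| ≤ k / E) (hu' : |u'| ≤ k / E) (hx' : |x'| ≤ k / E) :
    |outVel g E n u x - outVel g E n u' x'| ≤ g / (2 * √E) * (|u - u'| + |x - x'|) := by
  have h1 := R.gTime_pos hn hu hx
  have h2 := R.outVel_sub hn hu hx hu' hx'
  have h3 := R.gTime_ge hn hu hx
  have h6 := R.sqrt_pos'
  have hg := R.hg
  have h4 := abs_sub (x - x') (u - u')
  have h5 : |(outVel g E n u x - outVel g E n u' x') * gTime g E n u x| ≤
      1.01 * (g * (|u - u'| + |x - x'|)) := by
    have := abs_add_le ((outVel g E n u x - outVel g E n u' x') * gTime g E n u x -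
      g * ((x - x') - (u - u'))) (g * ((x - x') - (u - u')))
    rw [sub_add_cancel, abs_mul g, abs_of_pos hg] at this
    nlinarith
  rw [abs_mul, abs_of_pos h1] at h5
  rw [div_mul_eq_mul_div, le_div_iff₀ (by positivity)]
  have h7 := abs_nonneg (outVel g E n u x - outVel g E n u' x')
  have h8 : |outVel g E n u x - outVel g E n u' x'| * (2.7 * √E) ≤
      1.01 * (g * (|u - u'| + |x - x'|)) := le_trans (by gcongr) h5
  have h9 : 0 ≤ g * (|u - u'| + |x - x'|) := by positivity
  norm_num at h8
  nlinarith [mul_nonneg h7 h6.le]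

theorem outVel_strictMono (R : Regime g E k) (hn : |n| ≤ 1) {u x x' : ℝ} (hu : |u| ≤ k / E)
    (hx : |x| ≤ k / E) (hx' : |x'| ≤ k / E) (h : x < x') :
    outVel g E n u x < outVel g E n u x' := by
  have h1 := R.gTime_pos hn hu hx'
  have h2 := R.outVel_sub hn hu hx' hu hx
  rw [sub_self, abs_zero, abs_of_pos (sub_pos.2 h)] at h2
  have h3 := (abs_le.1 h2).1
  have h4 := mul_pos R.hg (sub_pos.2 h)
  have h5 : 0 < (outVel g E n u x' - outVel g E n u x) * gTime g E n u x' := by nlinarith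
  exact sub_pos.1 (pos_of_mul_pos_left h5 h1.le)

theorem outVel_strictAnti (R : Regime g E k) (hn : |n| ≤ 1) {u u' x : ℝ} (hu : |u| ≤ k / E)
    (hu' : |u'| ≤ k / E) (hx : |x| ≤ k / E) (h : u < u') :
    outVel g E n u' x < outVel g E n u x := by
  have h1 := R.gTime_pos hn hu hx
  have h2 := R.outVel_sub hn hu hx hu' hx
  rw [sub_self, abs_zero, abs_sub_comm u, abs_of_pos (sub_pos.2 h)] at h2
  have h3 := (abs_le.1 h2).1
  have h4 := mul_pos R.hg (sub_pos.2 h)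
  have h5 : 0 < (outVel g E n u x - outVel g E n u' x) * gTime g E n u x := by nlinarith
  exact sub_pos.1 (pos_of_mul_pos_left h5 h1.le)

/-- Two effects of the same sign: the reflection makes `backVel` fall steeply in `u`, and `outVel`,
in which `backVel` increases, also falls. -/
theorem inVel_steep (R : Regime g E k) (hn : |n| ≤ 1) {u u' x : ℝ} (hu : |u| ≤ k / E)
    (hu' : |u'| ≤ k / E) (hx : |x| ≤ k / E) (h : u ≤ u') :
    2 * √E * (u' - u) ≤ inVel g E n u x - inVel g E n u' x := by
  rcases h.eq_or_lt with rfl | h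
  · simp
  have w1 := R.abs_outVel_le hn hu hx
  have w2 := R.abs_outVel_le hn hu' hx
  have h1 := R.backVel_sub_left hu hu' (w := outVel g E n u x) (by linarith) h.le
  have h2 := (R.backVel_sub_right hu' (w' := outVel g E n u x) (w := outVel g E n u' x)
    (by linarith) (by linarith) (R.outVel_strictAnti hn hu hu' hx h).le).1
  have h3 := R.outVel_strictAnti hn hu hu' hx h
  have h4 := R.sqrt_pos'
  have h5 : 0 ≤ √E * (u' - u) := mul_nonneg h4.le (sub_nonneg.2 h.le)
  rw [inVel, inVel]
  norm_num at h1 h2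
  linarith

theorem inVel_sub (R : Regime g E k) (hn : |n| ≤ 1) {u x x' : ℝ} (hu : |u| ≤ k / E)
    (hx : |x| ≤ k / E) (hx' : |x'| ≤ k / E) (h : x < x') :
    inVel g E n u x < inVel g E n u x' ∧
      inVel g E n u x' - inVel g E n u x ≤ g / √E * (x' - x) := by
  have w1 := R.abs_outVel_le hn hu hx
  have w2 := R.abs_outVel_le hn hu hx'
  have h3 := R.outVel_strictMono hn hu hx hx' h
  have h2 := R.backVel_sub_right hu (w' := outVel g E n u x') (w := outVel g E n u x)
    (by linarith) (by linarith) h3.le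
  have h4 := R.abs_outVel_sub_le hn hu hx' hu hx
  rw [sub_self, abs_zero, zero_add, abs_of_pos (sub_pos.2 h), abs_of_pos (sub_pos.2 h3)] at h4
  rw [inVel, inVel]
  constructor
  · norm_num at h2; linarith
  · have e : g / (2 * √E) * (x' - x) = (g / √E * (x' - x)) / 2 := by field_simp
    have : 0 ≤ g / √E * (x' - x) :=
      mul_nonneg (div_nonneg R.hg.le (sqrt_nonneg _)) (sub_pos.2 h).le
    norm_num at h2
    linarith

theorem continuousOn_outVel (R : Regime g E k) (hn : |n| ≤ 1) {x : ℝ} (hx : |x| ≤ k / E) :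
    ContinuousOn (fun u => outVel g E n u x) (Icc (-(k / E)) (k / E)) := by
  refine continuousOn_of_lip (μ := g / (2 * √E))
    (div_nonneg R.hg.le (by positivity)) fun u hu u' hu' => ?_
  have := R.abs_outVel_sub_le hn (abs_le.2 hu) hx (abs_le.2 hu') hx
  simpa using this

theorem continuousOn_inVel (R : Regime g E k) (hn : |n| ≤ 1) {x : ℝ} (hx : |x| ≤ k / E) :
    ContinuousOn (fun u => inVel g E n u x) (Icc (-(k / E)) (k / E)) := by
  have hw := R.continuousOn_outVel hn hx
  unfold inVel backVel vertSpeed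
  refine ContinuousOn.div ?_ (by fun_prop) fun u _ => by positivity
  fun_prop

/-! ### The corners -/

/-- The free flight from `u` to `n * π + x`, with the velocity `outVel`. -/
theorem flight (R : Regime g E k) (hn : |n| ≤ 1) {u x : ℝ} (hu : |u| ≤ k / E)
    (hx : |x| ≤ k / E) :
    vertSpeed g E u (outVel g E n u x) + vertSpeed g E x (outVel g E n u x) = gTime g E n u x := by
  have hτ := R.gTime_pos hn hu hx
  have hge := R.gTime_ge hn hu hx
  have hsq := R.gTime_sq hn hu hx
  have hd := sq_sqrt (le_trans (by positivity) (R.disc_ge hn hu hx))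
  have hr := R.sqrt_ge
  have hrise := abs_le.1 (R.abs_rise_le hu hx)
  have hg := R.hg
  have hgr := R.g_le_sqrt
  set τ := gTime g E n u x with hτd
  -- Squaring recovers the quadratic equation for `τ ^ 2`.
  have hN : √(disc g E n u x) = τ ^ 2 / 2 - meanEnergy g E u x := by linarith
  rw [hN, disc] at hd
  have hq : g ^ 2 * ((n * π + x - u) ^ 2 + (cos x - cos u) ^ 2) =
      meanEnergy g E u x * τ ^ 2 - τ ^ 4 / 4 := by linarith
  have hne := hτ.ne'
  have q1 : g ^ 2 * ((n * π + x - u) ^ 2 + (cos x - cos u) ^ 2) / τ ^ 2 =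
      meanEnergy g E u x - τ ^ 2 / 4 := by rw [hq]; field_simp
  -- This makes `τ / 2 ± g * (cos x - cos u) / τ` nonnegative, so that they are the square roots in
  -- `vertSpeed` and not their negatives.
  have hbig : |g * (cos x - cos u) / τ| ≤ τ / 2 := by
    rw [abs_div, abs_mul, abs_of_pos hg, abs_of_pos hτ, div_le_iff₀ hτ]
    have := R.abs_rise_le hu hx
    have : g * |cos x - cos u| ≤ g * 1 := by gcongr
    norm_num at hge
    nlinarith
  have hb := abs_le.1 hbig
  have v1 : vertSpeed g E u (outVel g E n u x) = τ / 2 + g * (cos x - cos u) / τ := by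
    rw [vertSpeed, ← sqrt_sq (by linarith : 0 ≤ τ / 2 + g * (cos x - cos u) / τ)]
    congr 1
    have : (τ / 2 + g * (cos x - cos u) / τ) ^ 2 + (g * (n * π + x - u) / τ) ^ 2 =
        τ ^ 2 / 4 + g * (cos x - cos u) +
          g ^ 2 * ((n * π + x - u) ^ 2 + (cos x - cos u) ^ 2) / τ ^ 2 := by
      field_simp; ring
    rw [q1, meanEnergy] at this
    rw [outVel, ← hτd]
    linarith
  have v2 : vertSpeed g E x (outVel g E n u x) = τ / 2 - g * (cos x - cos u) / τ := by
    rw [vertSpeed, ← sqrt_sq (by linarith : 0 ≤ τ / 2 - g * (cos x - cos u) / τ)]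
    congr 1
    have : (τ / 2 - g * (cos x - cos u) / τ) ^ 2 + (g * (n * π + x - u) / τ) ^ 2 =
        τ ^ 2 / 4 - g * (cos x - cos u) +
          g ^ 2 * ((n * π + x - u) ^ 2 + (cos x - cos u) ^ 2) / τ ^ 2 := by
      field_simp; ring
    rw [q1, meanEnergy] at this
    rw [outVel, ← hτd]
    linarith
  rw [v1, v2]
  ring

theorem backVert_pos (R : Regime g E k) {u w : ℝ} (hu : |u| ≤ k / E) (hw : |w| ≤ 1) :
    0 < backVert g E u w := by
  have h1 := R.vertSpeed_ge (u := u) hw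
  have h2 := R.abs_sin_le hu
  have h3 := R.cos_ge hu
  have h4 := R.sqrt_ge
  have h5 : |2 * sin u * w| ≤ 2 * (1 / 10000) * 1 := by
    rw [abs_mul, abs_mul, abs_two]; gcongr
  have h6 := (abs_le.1 h5).1
  have h7 : 0.98 ≤ cos u ^ 2 := by norm_num at *; nlinarith
  rw [backVert]
  apply div_pos _ (by positivity)
  norm_num at *
  nlinarith

theorem abs_backVel_le (R : Regime g E k) {u w : ℝ} (hu : |u| ≤ k / E)
    (hw : |w| ≤ √2 * k / √E) : |backVel g E u w| ≤ 1 / 10 := by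
  have h1 := R.vertSpeed_le hu (w := w)
  have h2 : |sin u| ≤ k / E := abs_sin_le_abs.trans hu
  have h4 := R.omega_le
  have h5 := R.omega_eq
  have h6 : 0 ≤ vertSpeed g E u w := sqrt_nonneg _
  have h7 : |cos u ^ 2| ≤ 1 := by
    rw [abs_of_nonneg (sq_nonneg _)]; nlinarith [cos_sq' u, sq_nonneg (sin u)]
  have := R.kappa_pos
  rw [backVel, abs_div, abs_of_pos (by positivity : 0 < 1 + sin u ^ 2)]
  refine (div_le_self (abs_nonneg _) (by nlinarith [sq_nonneg (sin u)])).trans ?_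
  refine (abs_sub _ _).trans ?_
  rw [abs_mul, abs_mul, abs_mul, abs_two, abs_of_nonneg h6]
  calc |cos u ^ 2| * |w| + 2 * |sin u| * vertSpeed g E u w
      ≤ 1 * (√2 * k / √E) + 2 * (k / E) * (√2 * √E) := by gcongr
    _ = 3 * (√2 * k / √E) := by rw [h5]; ring
    _ ≤ _ := by linarith

/-- The condition on `k`, in the coordinates centered at `π / 2`. -/
theorem corner_eq (R : Regime g E k) (hA : A g E k = 0) :
    backVel g E (k / E) (√2 * k / √E) *
      vertSpeed g E (k / E) (backVel g E (k / E) (√2 * k / √E)) = -(g * π / 2) := by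
  have hκ : |k / E| ≤ k / E := (abs_of_pos R.kappa_pos).le
  have hc : 0 < cos (k / E) := by linarith [R.cos_ge hκ]
  have hg := R.hg
  -- The corner has offset `-(k / E)`, and the velocity after a collision at offset `u` is `backVel`
  -- at `-u`.
  have e1 : (reflect (collisionState g E (corner E k))).angVel =
      backVel g E (k / E) (√2 * k / √E) := by
    simp only [reflect, collisionState, corner, sin_pi_div_two_sub, cos_pi_div_two_sub,
      abs_of_pos hc, div_self hc.ne', backVel, vertSpeed]
    ring_nf
  rw [A, e1] at hA
  simp only [corner, sin_pi_div_two_sub, abs_of_pos hc] at hA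
  rw [vertSpeed]
  field_simp at hA ⊢
  linarith

/-- `A = 0` says that the level flight that starts after the corner collision advances by `-π`. It
therefore joins the left edges of two neighboring rectangles, which is `n = -1` with both offsets
`-(k / E)`. -/
theorem outVel_corner (R : Regime g E k) (hA : A g E k = 0) :
    outVel g E (-1) (-(k / E)) (-(k / E)) = backVel g E (k / E) (√2 * k / √E) := by
  have hκ : |k / E| ≤ k / E := (abs_of_pos R.kappa_pos).le
  have h1 := R.corner_eq hA
  have hw := R.abs_backVel_le hκ (w := √2 * k / √E) (abs_of_pos R.omega_pos).le
  set w := backVel g E (k / E) (√2 * k / √E)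
  have hS := R.vertSpeed_ge (u := k / E) (w := w) (by linarith)
  have hr := R.sqrt_ge
  have hg := R.hg
  norm_num at hS
  have hw2 : w ^ 2 ≤ 1 := by rw [← sq_abs]; nlinarith [abs_nonneg w]
  refine (gTime_eq (t := 2 * vertSpeed g E (k / E) w / g) hg ?_ ?_ ?_ ?_ ?_).2
  · rw [vertSpeed_neg]; linarith
  · rw [vertSpeed_neg]; linarith
  · rw [vertSpeed_neg]; nlinarith
  · rw [vertSpeed_neg]; field_simp; ring
  · field_simp
    linarith

theorem inVel_corner (R : Regime g E k) (hA : A g E k = 0) :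
    inVel g E (-1) (-(k / E)) (-(k / E)) = √2 * k / √E := by
  have hκ : |k / E| ≤ k / E := (abs_of_pos R.kappa_pos).le
  have hΩ : |√2 * k / √E| ≤ 1 := by rw [abs_of_pos R.omega_pos]; linarith [R.omega_le]
  rw [inVel, R.outVel_corner hA]
  refine backVel_neg_backVel ?_ (R.backVert_pos hκ hΩ).le
  exact (sqrt_pos.1 (R.vertSpeed_pos hΩ)).le

end Regime

/-! ### The image crosses the rectangles and stays within their heights -/

namespace Regime

variable {g E k n : ℝ}

/-- The angular velocity after the collision at the corner is smaller than that before it. -/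
theorem corner_outVel_le (R : Regime g E k) :
    -(√2 * k / √E * (1 - 3 / 4 * (g / E))) ≤ backVel g E (k / E) (√2 * k / √E) := by
  have hκ : |k / E| ≤ k / E := (abs_of_pos R.kappa_pos).le
  have hκ0 := R.kappa_pos
  have hκ1 := R.kappa_le
  have hΩ := R.omega_pos
  have hΩe := R.omega_eq
  have hE := R.E_pos
  have hg := R.hg
  have hcos := R.cos_ge hκ
  have hs : sin (k / E) ≤ k / E := sin_le hκ0.le
  have hs0 : 0 ≤ sin (k / E) := by
    have := le_sin_sub_sin (κ := k / E) (u := 0) (u' := k / E) (by linarith)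
      (by rw [abs_zero]; exact hκ0.le) hκ hκ0.le
    rw [sin_zero] at this
    norm_num at this
    linarith
  set Ω := √2 * k / √E with hΩd
  have hr := R.sqrt_pos'
  have hrr := R.sq_sqrt'
  have hgE : g / E ≤ 1 / 10000 := by
    rw [div_le_div_iff₀ hE (by norm_num)]; linarith [R.g_le]
  have hgE0 : 0 < g / E := div_pos hg hE
  -- With this the loss `(k / E) ^ 2` from `cos ^ 2` is negligible against the gain of about `0.99 *
  -- (g / E)` in `hS`, which comes from the potential energy at the corner; `3 / 4` leaves room.
  have hκ2 : (k / E) ^ 2 ≤ 1 / 10000 * (g / E) := by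
    rw [div_pow, ← mul_div_assoc, div_le_div_iff₀ (by positivity) hE]
    nlinarith [R.big']
  have hS : vertSpeed g E (k / E) Ω ≤ √2 * √E * (1 - 0.99 / 2 * (g / E)) := by
    apply sqrt_le_iff.2
    have h1 : 0 ≤ 1 - 0.99 / 2 * (g / E) := by linarith
    refine ⟨by positivity, ?_⟩
    have e : (√2 * √E * (1 - 0.99 / 2 * (g / E))) ^ 2 =
        2 * E - 2 * 0.99 * g + 2 * E * (0.99 / 2 * (g / E)) ^ 2 := by
      rw [mul_pow, mul_pow, sq_sqrt zero_le_two, hrr]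
      field_simp
      ring
    rw [e]
    have : 0 ≤ 2 * E * (0.99 / 2 * (g / E)) ^ 2 := by positivity
    nlinarith [sq_nonneg Ω]
  have hS0 : 0 ≤ vertSpeed g E (k / E) Ω := sqrt_nonneg _
  have h2 : 2 * sin (k / E) * vertSpeed g E (k / E) Ω ≤ 2 * Ω * (1 - 0.99 / 2 * (g / E)) := by
    calc _ ≤ 2 * (k / E) * (√2 * √E * (1 - 0.99 / 2 * (g / E))) := by gcongr
      _ = _ := by rw [hΩe]; ring
  have h3 : (1 - (k / E) ^ 2) * Ω ≤ cos (k / E) ^ 2 * Ω := by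
    rw [cos_sq']; gcongr
  have h4 : -(Ω * (1 - 3 / 4 * (g / E))) ≤
      cos (k / E) ^ 2 * Ω - 2 * sin (k / E) * vertSpeed g E (k / E) Ω := by
    have : (k / E) ^ 2 * Ω ≤ 1 / 10000 * (g / E) * Ω := by gcongr
    have : 0 < g / E * Ω := by positivity
    norm_num at h2
    linarith
  have h5 : 0 ≤ Ω * (1 - 3 / 4 * (g / E)) := mul_nonneg hΩ.le (by linarith)
  rw [backVel, le_div_iff₀ (by positivity)]
  refine le_trans ?_ h4
  nlinarith [mul_nonneg h5 (sq_nonneg (sin (k / E)))]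

/-- The function `a ↦ a * √(K - a ^ 2)` is increasing for `2 * a ^ 2 ≤ K`. -/
theorem mul_le_mul_of_sq_eq {a b B S K : ℝ} (ha : 0 ≤ a) (hab : a ≤ b) (hB : 0 ≤ B) (hS : 0 ≤ S)
    (h1 : B ^ 2 = K - a ^ 2) (h2 : S ^ 2 = K - b ^ 2) (h : b ^ 2 + a ^ 2 ≤ K) :
    a * B ≤ b * S := by
  apply (sq_le_sq₀ (by positivity) (mul_nonneg (ha.trans hab) hS)).1
  rw [mul_pow, mul_pow, h1, h2]
  have h3 : 0 ≤ b ^ 2 - a ^ 2 := sub_nonneg.2 (by gcongr)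
  have h4 := mul_nonneg h3 (sub_nonneg.2 h)
  linarith

-- Compare with the corner flight, whose velocity `c` satisfies `|c| ≤ Ω * (1 - 3 / 4 * (g / E))`
-- and which advances by `π`. The present flight has to cover `k / E` more. If it needed a speed
-- above `Ω`, then `2 * Ω * B ≤ g * (π + k / E)` for the vertical speed `B` at the top with angular
-- velocity `Ω`. The corner flight gives `g * π ≤ 2 * Ω * B * (1 - 0.7 * (g / E))`, and as `Ω * B`
-- is about `2 * k`, its deficit exceeds `g * k / E`.
set_option maxHeartbeats 800000 in
theorem neg_omega_le_outVel (R : Regime g E k) (hA : A g E k = 0) :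
    -(√2 * k / √E) ≤ outVel g E (-1) 0 (-(k / E)) := by
  have hκ : |k / E| ≤ k / E := (abs_of_pos R.kappa_pos).le
  have hκ0 := R.kappa_pos
  have hκ' : |-(k / E)| ≤ k / E := by rwa [abs_neg]
  have h00 : |(0 : ℝ)| ≤ k / E := by rw [abs_zero]; exact hκ0.le
  have h1 := R.corner_eq hA
  have h2 := R.corner_outVel_le
  have hwb := R.abs_backVel_le hκ (w := √2 * k / √E) (abs_of_pos R.omega_pos).le
  have hn : |(-1 : ℝ)| ≤ 1 := by simp
  have hflight := R.flight hn h00 hκ'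
  have hout : outVel g E (-1) 0 (-(k / E)) * gTime g E (-1) 0 (-(k / E)) =
      -(g * (π + k / E)) := by
    rw [outVel, div_mul_cancel₀ _ (R.gTime_pos hn h00 hκ').ne']; ring
  have hw0 := R.abs_outVel_le hn h00 hκ'
  rw [← hflight, vertSpeed_neg] at hout
  generalize outVel g E (-1) 0 (-(k / E)) = w at *
  by_contra! hlt
  have hΩ := R.omega_pos
  have hΩe := R.omega_eq
  have hΩ1 := R.omega_le
  set Ω := √2 * k / √E with hΩd
  have hE := R.E_pos
  have hg := R.hg
  have hr := R.sqrt_ge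
  have hrr := R.sq_sqrt'
  have hcos := R.cos_ge hκ
  have hcos1 := cos_le_one (k / E)
  have hcosb := one_sub_sq_div_two_le_cos (x := k / E)
  have hgE : g / E ≤ 1 / 10000 := by
    rw [div_le_div_iff₀ hE (by norm_num)]; linarith [R.g_le]
  have hgE0 : 0 < g / E := div_pos hg hE
  -- the two ends of the flight
  have hB := R.vertSpeed_ge (u := 0) (w := Ω) (by rw [abs_of_pos hΩ]; linarith)
  have hB2 := R.vertSpeed_sq (u := 0) (w := Ω) (by rw [abs_of_pos hΩ]; linarith)
  have hS := R.vertSpeed_ge (u := 0) (w := w) (by linarith)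
  have hS2 := R.vertSpeed_sq (u := 0) (w := w) (by linarith)
  have hSκ : vertSpeed g E 0 w ≤ vertSpeed g E (k / E) w := by
    apply sqrt_le_sqrt
    rw [cos_zero]
    nlinarith
  rw [cos_zero] at hB2 hS2
  set B := vertSpeed g E 0 Ω
  set S := vertSpeed g E 0 w
  norm_num at hB hS
  have hwlow := (abs_le.1 hw0).1
  have hg4 := R.g_le
  have hB0 : 0 ≤ B := sqrt_nonneg _
  have hw' : 0 ≤ -w := by linarith
  have h3 : Ω * B ≤ -w * S := by
    refine mul_le_mul_of_sq_eq (K := 2 * E - 2 * g) hΩ.le (by linarith) hB0 (sqrt_nonneg _)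
      (by linarith) (by rw [hS2]; ring) ?_
    have : (-w) ^ 2 ≤ 1 := by nlinarith
    have : Ω ^ 2 ≤ 1 := by nlinarith
    linarith [R.E_ge]
  have h4 : 2 * (Ω * B) ≤ g * (π + k / E) := by
    have := mul_le_mul_of_nonneg_left hSκ hw'
    linarith
  -- the flight that starts at the corner
  set c := backVel g E (k / E) Ω
  have hSc := R.vertSpeed_ge (u := k / E) (w := c) (by linarith)
  have hSc2 := R.vertSpeed_sq (u := k / E) (w := c) (by linarith)
  have hk2 := R.big'
  have hκ2 : (k / E) ^ 2 ≤ 1 / 10000 := by nlinarith [R.kappa_le]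
  have hΩ2 : Ω ^ 2 ≤ 2 / 10000 * g := by
    rw [hΩd, div_pow, mul_pow, sq_sqrt zero_le_two, hrr, div_le_iff₀ hE]
    linarith
  have hE2 : E * (g / E) = g := by field_simp
  have h5 : vertSpeed g E (k / E) c ≤ B * (1 + g / E / 1000) := by
    apply sqrt_le_iff.2
    refine ⟨by positivity, ?_⟩
    have a1 : B ^ 2 * (1 + g / E / 500) ≤ (B * (1 + g / E / 1000)) ^ 2 := by
      rw [mul_pow]
      have : 0 ≤ B ^ 2 * (g / E / 1000) ^ 2 := by positivity
      have e : B ^ 2 * (1 + g / E / 1000) ^ 2 =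
        B ^ 2 * (1 + g / E / 500) + B ^ 2 * (g / E / 1000) ^ 2 := by ring
      linarith
    have a2 : E * (g / E / 500) ≤ B ^ 2 * (g / E / 500) := by
      gcongr
      rw [hB2]
      have : Ω ^ 2 ≤ 1 := by nlinarith
      linarith [R.E_ge]
    have a3 : g * (1 - (k / E) ^ 2 / 2) ≤ g * cos (k / E) := by gcongr
    have a4 : g * (k / E) ^ 2 ≤ g * (1 / 10000) := by gcongr
    linarith [sq_nonneg c]
  have h6 : -c * vertSpeed g E (k / E) c ≤
      Ω * (1 - 3 / 4 * (g / E)) * (B * (1 + g / E / 1000)) := by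
    have : 0 ≤ Ω * (1 - 3 / 4 * (g / E)) := mul_nonneg hΩ.le (by linarith)
    have a0 : 0 ≤ vertSpeed g E (k / E) c := sqrt_nonneg _
    gcongr
    linarith
  have h7 : (1 - 3 / 4 * (g / E)) * (1 + g / E / 1000) ≤ 1 - 0.7 * (g / E) := by nlinarith
  have hΩB : 1.9 * k ≤ Ω * B := by
    have a1 : 1.4 ≤ √2 := by apply le_sqrt_of_sq_le; norm_num
    have a2 : √2 * (k / E * √E) * (1.41 * √E) = √2 * 1.41 * k := by
      have : √2 * (k / E * √E) * (1.41 * √E) = √2 * 1.41 * (k / E) * √E ^ 2 := by ring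
      rw [this, hrr, mul_assoc (√2 * 1.41), R.kappa_mul]
    have a3 : √2 * (k / E * √E) * (1.41 * √E) ≤ Ω * B := by
      rw [hΩe]; gcongr
      norm_num; exact hB
    have := R.hk
    rw [a2] at a3
    refine le_trans ?_ a3
    gcongr
    norm_num
    linarith
  have h8 : Ω * (1 - 3 / 4 * (g / E)) * (B * (1 + g / E / 1000)) ≤
      Ω * B * (1 - 0.7 * (g / E)) := by
    have : 0 ≤ Ω * B := by nlinarith [R.hk]
    calc _ = Ω * B * ((1 - 3 / 4 * (g / E)) * (1 + g / E / 1000)) := by ring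
      _ ≤ _ := by gcongr
  have h9 : 1.9 * k * (g / E) ≤ Ω * B * (g / E) := by gcongr
  have h10 : k * (g / E) = g * (k / E) := by ring
  have h11 : 0 < k * (g / E) := mul_pos R.hk hgE0
  norm_num at h8 h9
  -- Together: `g * π ≤ 2 * Ω * B - 1.4 * 1.9 * (g * k / E)` and `2 * Ω * B ≤ g * π + g * k / E`,
  -- which is impossible as `1.4 * 1.9 > 1`.
  linarith

theorem outVel_nonneg (R : Regime g E k) (hn : n = 0 ∨ n = 1) {x : ℝ} (hx : |x| ≤ k / E) :
    0 ≤ outVel g E n (-(k / E)) x := by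
  have := abs_le.1 hx
  refine div_nonneg (mul_nonneg R.hg.le ?_) (sqrt_nonneg _)
  rcases hn with rfl | rfl
  · linarith
  · linarith [pi_pos]

/-- The left side is `√2 * (k / E) * √E`, and the right side is close to `2 * sin (k / E) * √(2 *
E)`, about twice as much. -/
theorem omega_le_backVel (R : Regime g E k) : √2 * k / √E ≤ backVel g E (-(k / E)) 0 := by
  have hκ : |k / E| ≤ k / E := (abs_of_pos R.kappa_pos).le
  have hκ' : |-(k / E)| ≤ k / E := by rwa [abs_neg]
  have h1 := R.vertSpeed_ge (u := -(k / E)) (w := 0) (by simp)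
  have h0 : |(0 : ℝ)| ≤ k / E := by rw [abs_zero]; exact R.kappa_pos.le
  have h2 := le_sin_sub_sin (R.kappa_le.trans (by norm_num)) h0 hκ R.kappa_pos.le
  have h3 := abs_le.1 (R.abs_sin_le hκ)
  have hr := R.sqrt_pos'
  have hκ0 := R.kappa_pos
  rw [sin_zero] at h2
  have h5 : √2 ≤ 1.42 := by rw [sqrt_le_left (by norm_num)]; norm_num
  rw [backVel, R.omega_eq, sin_neg, le_div_iff₀ (by positivity)]
  have h4 : (-sin (k / E)) ^ 2 ≤ 1 / 10000 := by nlinarith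
  have h6 : 0 < k / E * √E := by positivity
  have h7 : (0.99 * (k / E)) * (1.41 * √E) ≤ sin (k / E) * vertSpeed g E (-(k / E)) 0 := by
    have : 0.99 * (k / E) ≤ sin (k / E) := by linarith
    gcongr
    exact le_trans (by positivity) this
  have h8 : √2 * (k / E * √E) * (1 + (-sin (k / E)) ^ 2) ≤
      1.42 * (k / E * √E) * (1 + 1 / 10000) := by gcongr
  refine h8.trans ?_
  norm_num at h7 ⊢
  nlinarith

/-- The case `n = -1` is sharp: `inVel` increases in `x`, and at `x = -(k / E)` it equals `√2 * k /
√E` by the choice of `k`. For `n = 0, 1` the flight from the left edge does not go backwards, so the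
velocity before the collision is at least that for outgoing velocity `0`. -/
theorem omega_le_inVel (R : Regime g E k) (hA : A g E k = 0) (hn : n = -1 ∨ n = 0 ∨ n = 1)
    {x : ℝ} (hx : |x| ≤ k / E) : √2 * k / √E ≤ inVel g E n (-(k / E)) x := by
  have hκ : |k / E| ≤ k / E := (abs_of_pos R.kappa_pos).le
  have hκ' : |-(k / E)| ≤ k / E := by rwa [abs_neg]
  rcases hn with rfl | hn
  · rw [← R.inVel_corner hA]
    rcases (abs_le.1 hx).1.eq_or_lt with rfl | h
    · exact le_rfl
    · exact (R.inVel_sub (by simp) hκ' hκ' hx h).1.le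
  · have hn1 : |n| ≤ 1 := by rcases hn with rfl | rfl <;> simp
    have h0 := R.outVel_nonneg hn hx
    have h2 := (R.backVel_sub_right hκ' (w := 0) (by simp)
      ((R.abs_outVel_le hn1 hκ' hx).trans (by norm_num)) h0).1
    refine R.omega_le_backVel.trans ?_
    rw [inVel]
    norm_num at h2
    linarith

theorem inVel_le_neg_omega (R : Regime g E k) (hA : A g E k = 0) (hn : n = -1 ∨ n = 0 ∨ n = 1)
    {x : ℝ} (hx : |x| ≤ k / E) : inVel g E n (k / E) x ≤ -(√2 * k / √E) := by
  have h := R.omega_le_inVel hA (n := -n) (x := -x)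
    (by rcases hn with rfl | rfl | rfl <;> simp) (by rwa [abs_neg])
  rw [inVel_neg] at h
  linarith

/-- For `u ≤ 0` monotonicity in both offsets reduces to the flight from `0` to the left edge. For `u
> 0` the reflection has increased the angular velocity, so the lower bound on `inVel` passes to
`outVel`. -/
theorem neg_omega_le_outVel_of_le (R : Regime g E k) (hA : A g E k = 0) {u x : ℝ}
    (hu : |u| ≤ k / E) (hx : |x| ≤ k / E) (h : -(√2 * k / √E) ≤ inVel g E (-1) u x) :
    -(√2 * k / √E) ≤ outVel g E (-1) u x := by
  have hκ' : |-(k / E)| ≤ k / E := by rw [abs_neg, abs_of_pos R.kappa_pos]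
  have h0 : |(0 : ℝ)| ≤ k / E := by rw [abs_zero]; exact R.kappa_pos.le
  have hn : |(-1 : ℝ)| ≤ 1 := by simp
  rcases le_or_gt u 0 with hu0 | hu0
  · refine (R.neg_omega_le_outVel hA).trans ?_
    have h1 : outVel g E (-1) 0 (-(k / E)) ≤ outVel g E (-1) 0 x := by
      rcases (abs_le.1 hx).1.eq_or_lt with rfl | h
      · exact le_rfl
      · exact (R.outVel_strictMono hn h0 hκ' hx h).le
    refine h1.trans ?_
    rcases hu0.eq_or_lt with rfl | h
    · exact le_rfl
    · exact (R.outVel_strictAnti hn hu h0 hx h).le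
  · refine h.trans ?_
    have h1 := R.backVel_sub_left h0 hu (w := outVel g E (-1) u x)
      ((R.abs_outVel_le hn hu hx).trans (by norm_num)) hu0.le
    have h2 : backVel g E 0 (outVel g E (-1) u x) = outVel g E (-1) u x := by simp [backVel]
    rw [h2] at h1
    have : 0 ≤ 2.5 * √E * (u - 0) := mul_nonneg (by positivity) (by linarith)
    rw [inVel]
    linarith

theorem outVel_neg_one_nonpos (R : Regime g E k) {u x : ℝ}
    (hu : |u| ≤ k / E) (hx : |x| ≤ k / E) : outVel g E (-1) u x ≤ 0 := by
  have := abs_le.1 hx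
  have := abs_le.1 hu
  have := R.kappa_le
  refine div_nonpos_of_nonpos_of_nonneg ?_ (sqrt_nonneg _)
  refine mul_nonpos_of_nonneg_of_nonpos R.hg.le ?_
  linarith [pi_gt_three]

theorem outVel_zero_mem (R : Regime g E k) {u x : ℝ}
    (hu : |u| ≤ k / E) (hx : |x| ≤ k / E) : |outVel g E 0 u x| ≤ √2 * k / √E := by
  have hn : |(0 : ℝ)| ≤ 1 := by simp
  have h1 := R.gTime_pos hn hu hx
  have h2 := R.gTime_ge hn hu hx
  have h3 := abs_sub x u
  have hg := R.hg
  have hr := R.sqrt_pos'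
  have hκ := R.kappa_pos
  rw [outVel, abs_div, abs_of_pos h1, div_le_iff₀ h1, abs_mul, abs_of_pos hg, zero_mul, zero_add,
    R.omega_eq]
  have h5 : 1 ≤ √2 := by apply le_sqrt_of_sq_le; norm_num
  calc g * |x - u| ≤ √E / 100 * (2 * (k / E)) := by
        gcongr
        · linarith [R.g_le_sqrt]
        · linarith
    _ ≤ 1 * (k / E * √E) * 1 := by nlinarith [mul_pos hr hκ]
    _ ≤ √2 * (k / E * √E) * gTime g E 0 u x := by
        gcongr
        norm_num at h2
        linarith [R.sqrt_ge]

theorem isTwist (R : Regime g E k) (hA : A g E k = 0) (hn : n = -1 ∨ n = 0 ∨ n = 1) :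
    IsTwist (k / E) (√2 * k / √E) (2 * √E) (g / √E) (g / (2 * √E)) (inVel g E n)
      (outVel g E n) := by
  have hn1 : |n| ≤ 1 := by rcases hn with rfl | rfl | rfl <;> simp
  refine ⟨R.kappa_pos, fun x hx => R.continuousOn_inVel hn1 (abs_le.2 hx),
    fun x hx => R.continuousOn_outVel hn1 (abs_le.2 hx),
    fun x hx u hu u' hu' h => R.inVel_steep hn1 (abs_le.2 hu) (abs_le.2 hu') (abs_le.2 hx) h,
    fun u hu x hx x' hx' h => (R.inVel_sub hn1 (abs_le.2 hu) (abs_le.2 hx) (abs_le.2 hx') h).1,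
    ?_,
    fun x hx u hu u' hu' h => R.outVel_strictAnti hn1 (abs_le.2 hu) (abs_le.2 hu') (abs_le.2 hx) h,
    fun u hu u' hu' x hx x' hx' =>
      R.abs_outVel_sub_le hn1 (abs_le.2 hu) (abs_le.2 hx) (abs_le.2 hu') (abs_le.2 hx'),
    fun x hx => R.omega_le_inVel hA hn (abs_le.2 hx),
    fun x hx => R.inVel_le_neg_omega hA hn (abs_le.2 hx), ?_⟩
  · intro u hu x hx x' hx'
    rcases lt_trichotomy x x' with h | rfl | h
    · have := R.inVel_sub hn1 (abs_le.2 hu) (abs_le.2 hx) (abs_le.2 hx') h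
      rw [abs_sub_comm, abs_of_pos (sub_pos.2 this.1), abs_sub_comm x, abs_of_pos (sub_pos.2 h)]
      exact this.2
    · simp
    · have := R.inVel_sub hn1 (abs_le.2 hu) (abs_le.2 hx') (abs_le.2 hx) h
      rw [abs_of_pos (sub_pos.2 this.1), abs_of_pos (sub_pos.2 h)]
      exact this.2
  · intro u hu x hx h
    have hu' := abs_le.2 hu
    have hx' := abs_le.2 hx
    rcases hn with rfl | rfl | rfl
    · exact ⟨R.neg_omega_le_outVel_of_le hA hu' hx' h.1,
        (R.outVel_neg_one_nonpos hu' hx').trans R.omega_pos.le⟩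
    · exact abs_le.1 (R.outVel_zero_mem hu' hx')
    · have hu2 : |-u| ≤ k / E := by rwa [abs_neg]
      have hx2 : |-x| ≤ k / E := by rwa [abs_neg]
      have e1 := inVel_neg g E 1 u x
      have e2 := outVel_neg g E 1 u x
      have h1 := R.neg_omega_le_outVel_of_le hA hu2 hx2 (by rw [e1]; linarith [h.2])
      have h2 := R.outVel_neg_one_nonpos hu2 hx2
      rw [e2] at h1 h2
      exact ⟨by linarith [R.omega_pos], by linarith⟩

end Regime

/-! ### The time of flight -/

theorem abs_sin_add_le (θ δ : ℝ) : |sin (θ + δ)| ≤ |sin θ| + |δ| := by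
  have h := abs_sin_sub_sin_le (θ + δ) θ
  rw [add_sub_cancel_left] at h
  have := abs_sub_abs_le_abs_sub (sin (θ + δ)) (sin θ)
  linarith

/-- A free motion that starts on the boundary with a steep velocity stays in the domain for some
time. -/
theorem abs_sin_le_fly {g : ℝ} (hg : 0 < g) {s : State} (hs : s.height = |sin s.angle|) {t : ℝ}
    (ht : 0 ≤ t) (htt : t ≤ 2 * (s.vertVel - |s.angVel|) / g) :
    |sin (fly g t s).angle| ≤ (fly g t s).height := by
  have h1 := abs_sin_add_le s.angle (s.angVel * t)
  rw [abs_mul, abs_of_nonneg ht] at h1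
  rw [le_div_iff₀ hg] at htt
  simp only [fly]
  nlinarith

theorem abs_sin_lt_fly {g : ℝ} (hg : 0 < g) {s : State} (hs : s.height = |sin s.angle|) {t : ℝ}
    (ht : 0 < t) (htt : t < 2 * (s.vertVel - |s.angVel|) / g) :
    |sin (fly g t s).angle| < (fly g t s).height := by
  have h1 := abs_sin_add_le s.angle (s.angVel * t)
  rw [abs_mul, abs_of_pos ht] at h1
  rw [lt_div_iff₀ hg] at htt
  simp only [fly]
  nlinarith

/-- A free motion that hits the boundary with a steep velocity is in the domain for some time
before. -/
theorem abs_sin_lt_fly_of_hit {g : ℝ} (hg : 0 < g) {s : State} {T : ℝ}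
    (hT : (fly g T s).height = |sin (fly g T s).angle|) {t : ℝ}
    (ht : t < T) (htt : T - t < 2 * (g * T - s.vertVel - |s.angVel|) / g) :
    |sin (fly g t s).angle| < (fly g t s).height := by
  have h1 := abs_sin_add_le (s.angle + s.angVel * T) (s.angVel * (t - T))
  rw [abs_mul, abs_of_neg (sub_neg.2 ht)] at h1
  rw [lt_div_iff₀ hg] at htt
  simp only [fly] at hT ⊢
  have e : s.angle + s.angVel * T + s.angVel * (t - T) = s.angle + s.angVel * t := by ring
  rw [e] at h1
  nlinarith

/-- The boundary has slope at most `1`, so contact is excluded for a time `2 * (v - |w|) / g` after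
the start and `2 * (g * T - v - |w|) / g` before the end. These intervals cover the whole flight
when `4 * |w| < g * T`. -/
theorem hitTime_eq {g : ℝ} (hg : 0 < g) {s : State} (hs : s.height = |sin s.angle|) {T : ℝ}
    (hT0 : 0 < T) (hT : (fly g T s).height = |sin (fly g T s).angle|)
    (hlong : 4 * |s.angVel| < g * T) : hitTime g s = T := by
  refine IsLeast.csInf_eq ⟨⟨hT0, hT⟩, fun t ht => ?_⟩
  by_contra! hlt
  have h1 : 2 * (s.vertVel - |s.angVel|) / g ≤ t := by
    by_contra! h
    exact (abs_sin_lt_fly hg hs ht.1 h).ne' ht.2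
  have h2 : 2 * (g * T - s.vertVel - |s.angVel|) / g ≤ T - t := by
    by_contra! h
    exact (abs_sin_lt_fly_of_hit hg hT hlt h).ne' ht.2
  rw [div_le_iff₀ hg] at h1 h2
  nlinarith

/-- Since contact is excluded before `t₀ > 0`, the open condition `0 < t` may be replaced by `t₀ ≤
t`. The set of contact times is then closed, and its infimum is attained. -/
theorem hitTime_spec {g : ℝ} (hg : 0 < g) {s : State} (hs : s.height = |sin s.angle|)
    (hv : |s.angVel| < s.vertVel) :
    2 * (s.vertVel - |s.angVel|) / g ≤ hitTime g s ∧
      (fly g (hitTime g s) s).height = |sin (fly g (hitTime g s) s).angle| := by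
  set t₀ := 2 * (s.vertVel - |s.angVel|) / g with ht₀
  have ht₀pos : 0 < t₀ := div_pos (by linarith) hg
  have hset : {t : ℝ | 0 < t ∧ (fly g t s).height = |sin (fly g t s).angle|} =
      Ici t₀ ∩ {t | (fly g t s).height = |sin (fly g t s).angle|} := by
    ext t
    constructor
    · rintro ⟨h1, h2⟩
      refine ⟨?_, h2⟩
      by_contra! h
      exact (abs_sin_lt_fly hg hs h1 (not_le.1 h)).ne' h2
    · rintro ⟨h1, h2⟩
      exact ⟨lt_of_lt_of_le ht₀pos h1, h2⟩
  have hc1 : Continuous fun t => (fly g t s).height := by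
    simp only [fly]; fun_prop
  have hc2 : Continuous fun t => |sin (fly g t s).angle| := by
    simp only [fly]; fun_prop
  have hclosed : IsClosed (Ici t₀ ∩ {t | (fly g t s).height = |sin (fly g t s).angle|}) :=
    isClosed_Ici.inter (isClosed_eq hc1 hc2)
  have hne : (Ici t₀ ∩ {t | (fly g t s).height = |sin (fly g t s).angle|}).Nonempty := by
    -- At this time the height is `|sin s.angle| - t₁ * (1 + g)` with `t₁ ≥ 2`, hence negative.
    set t₁ := 2 * (s.vertVel + 1 + g) / g with ht₁
    have h01 : t₀ ≤ t₁ := by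
      rw [ht₀, ht₁]
      gcongr
      linarith [abs_nonneg s.angVel]
    have hend : (fly g t₁ s).height - |sin (fly g t₁ s).angle| ≤ 0 := by
      have h1 : g * t₁ = 2 * (s.vertVel + 1 + g) := by rw [ht₁]; field_simp
      have h2 : 2 ≤ t₁ := by
        rw [ht₁, le_div_iff₀ hg]
        linarith [abs_nonneg s.angVel]
      have h3 : (fly g t₁ s).height = |sin s.angle| - t₁ * (1 + g) := by
        simp only [fly, hs]
        linear_combination (-t₁ / 2) * h1
      rw [h3]
      have := abs_sin_le_one s.angle
      have := abs_nonneg (sin (fly g t₁ s).angle)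
      nlinarith
    have hstart : 0 ≤ (fly g t₀ s).height - |sin (fly g t₀ s).angle| :=
      sub_nonneg.2 (abs_sin_le_fly hg hs ht₀pos.le le_rfl)
    obtain ⟨t, ht, ht'⟩ := intermediate_value_Icc' h01 (hc1.sub hc2).continuousOn ⟨hend, hstart⟩
    exact ⟨t, ht.1, by simpa [sub_eq_zero] using ht'⟩
  have hmem := hclosed.csInf_mem hne ⟨t₀, fun t ht => ht.1⟩
  rw [← hset] at hmem
  have hmem' : hitTime g s ∈ {t : ℝ | 0 < t ∧ (fly g t s).height = |sin (fly g t s).angle|} := hmem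
  rw [hset] at hmem'
  exact hmem'

/-! ### The return map in centered coordinates -/

/-- The sign `σ` of the sine at the center is the only difference between the two masses; it cancels
in the reflection. -/
theorem sin_center_add (a : Side) (u : ℝ) :
    ∃ σ : ℝ, |σ| = 1 ∧ σ * σ = 1 ∧ sin (a.center + u) = σ * cos u ∧
      cos (a.center + u) = -(σ * sin u) := by
  cases a
  · refine ⟨1, by simp, by simp, ?_, ?_⟩
    · rw [Side.center, add_comm, sin_add_pi_div_two, one_mul]
    · rw [Side.center, add_comm, cos_add_pi_div_two, one_mul]
  · refine ⟨-1, by simp, by simp, ?_, ?_⟩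
    · have : Side.R.center + u = (u + π / 2) + π := by simp only [Side.center]; ring
      rw [this, sin_add_pi, sin_add_pi_div_two]; ring
    · have : Side.R.center + u = (u + π / 2) + π := by simp only [Side.center]; ring
      rw [this, cos_add_pi, cos_add_pi_div_two]; ring

theorem abs_sin_center_add (a : Side) (u : ℝ) (hu : 0 ≤ cos u) (m : ℤ) :
    |sin (a.center + m * π + u)| = cos u := by
  obtain ⟨σ, h1, -, h2, -⟩ := sin_center_add a u
  have : a.center + m * π + u = (a.center + u) + m * π := by ring
  rw [this, sin_add_int_mul_pi, abs_mul, h2, abs_mul, h1, abs_of_nonneg hu, abs_zpow]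
  simp

theorem abs_sin_center_add' (a : Side) (u : ℝ) (hu : 0 ≤ cos u) :
    |sin (a.center + u)| = cos u := by
  simpa using abs_sin_center_add a u hu 0

theorem reflect_collisionState (g E : ℝ) (a : Side) {u : ℝ} (hu : 0 < cos u) (ω : ℝ) :
    reflect (collisionState g E (a.center + u, ω)) =
      ⟨a.center + u, cos u, backVel g E (-u) ω, backVert g E (-u) ω⟩ := by
  obtain ⟨σ, h1, h2, h3, h4⟩ := sin_center_add a u
  have h7 : |σ * cos u| = cos u := by rw [abs_mul, h1, abs_of_pos hu, one_mul]
  simp only [reflect, collisionState, h3, h4, h7, backVel, backVert, vertSpeed, cos_neg, sin_neg,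
    State.mk.injEq, true_and]
  have h5 : σ * cos u / cos u = σ := by field_simp
  have h6 : σ ^ 2 = 1 := by rw [sq, h2]
  rw [h5, neg_sq, mul_pow, mul_pow, h6]
  constructor
  · linear_combination (2 * sin u * √(2 * E - 2 * g * cos u - ω ^ 2) / (1 + sin u ^ 2)) * h2
  · linear_combination (-2 * sin u * ω / (1 + sin u ^ 2)) * h2

namespace Regime

variable {g E k : ℝ}

/-- A collision in a rectangle that is followed by a collision near the middle of a mass. -/
theorem landing (R : Regime g E k) {a : Side} {u ω x ω₁ : ℝ} {m : ℤ} (hu : |u| ≤ k / E)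
    (hω : |ω| ≤ √2 * k / √E) (hx : |x| ≤ k / E)
    (hf : f g E (a.center + u, ω) = (a.center + m * π + x, ω₁)) :
    ω₁ = backVel g E (-u) ω ∧ ∃ t, g * t = vertSpeed g E u ω₁ + vertSpeed g E x ω₁ ∧
      ω₁ * t = m * π + x - u := by
  have hu' : |-u| ≤ k / E := by rwa [abs_neg]
  have hcu := R.cos_ge hu
  have hcx := R.cos_ge hx
  have hg := R.hg
  have hΩ := R.omega_le
  have hw := R.abs_backVel_le hu' hω
  have hv : vertSpeed g E u (backVel g E (-u) ω) = backVert g E (-u) ω := by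
    rw [← vertSpeed_neg]
    exact vertSpeed_backVel (sqrt_pos.1 (R.vertSpeed_pos (by linarith))).le
      (R.backVert_pos hu' (by linarith)).le
  have hr := reflect_collisionState g E a (u := u) (by linarith) ω
  rw [f, returnMap, hr, ← hv] at hf
  have hvge := R.vertSpeed_ge (u := u) (w := backVel g E (-u) ω) (by linarith)
  have hv2 := R.vertSpeed_sq (u := u) (w := backVel g E (-u) ω) (by linarith)
  have hs := R.sqrt_ge
  norm_num at hvge
  obtain ⟨h1, h2⟩ := hitTime_spec (g := g) hg
    (s := ⟨a.center + u, cos u, backVel g E (-u) ω, vertSpeed g E u (backVel g E (-u) ω)⟩)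
    (abs_sin_center_add' a u (by linarith)).symm (by dsimp only; linarith)
  generalize hitTime g ⟨a.center + u, cos u, backVel g E (-u) ω,
    vertSpeed g E u (backVel g E (-u) ω)⟩ = t at *
  obtain ⟨hf1, hf2⟩ := Prod.mk.inj hf
  rw [hf1, abs_sin_center_add a x (by linarith) m] at h2
  simp only [fly] at hf1 hf2 h1 h2
  subst hf2
  refine ⟨rfl, t, ?_, by linarith⟩
  rw [div_le_iff₀ hg] at h1
  generalize vertSpeed g E u (backVel g E (-u) ω) = v at *
  -- By `h1` the landing is on the descending branch, `v ≤ g * t`, which fixes the sign of the root.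
  have h3 : vertSpeed g E x (backVel g E (-u) ω) = g * t - v := by
    rw [vertSpeed, ← sqrt_sq (by linarith : 0 ≤ g * t - v)]
    congr 1
    linear_combination (2 * g) * h2 - hv2
  rw [h3]
  ring

/-- The angular velocity is small against both vertical speeds, so the flight is the steep one and
its ends determine the velocities. -/
theorem outVel_eq_of_landing (R : Regime g E k) {a : Side} {u ω x ω₁ : ℝ} {m : ℤ}
    (hu : |u| ≤ k / E)
    (hω : |ω| ≤ √2 * k / √E) (hx : |x| ≤ k / E)
    (hf : f g E (a.center + u, ω) = (a.center + m * π + x, ω₁)) :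
    ω = inVel g E m u x ∧ ω₁ = outVel g E m u x := by
  obtain ⟨rfl, t, ht, hδ⟩ := R.landing hu hω hx hf
  have hu' : |-u| ≤ k / E := by rwa [abs_neg]
  have hΩ := R.omega_le
  have hw := R.abs_backVel_le hu' hω
  have h1 := R.vertSpeed_ge (u := u) (w := backVel g E (-u) ω) (by linarith)
  have h2 := R.vertSpeed_ge (u := x) (w := backVel g E (-u) ω) (by linarith)
  have hs := R.sqrt_ge
  norm_num at h1 h2
  have h3 : backVel g E (-u) ω ^ 2 ≤ 1 := by
    rw [← sq_abs]; nlinarith [abs_nonneg (backVel g E (-u) ω)]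
  have h4 := (gTime_eq R.hg (R.vertSpeed_pos (by linarith)) (R.vertSpeed_pos (by linarith))
    (by nlinarith) ht hδ).2
  refine ⟨?_, h4.symm⟩
  rw [inVel, h4]
  have := backVel_neg_backVel (g := g) (E := E) (u := -u) (w := ω)
    (sqrt_pos.1 (R.vertSpeed_pos (by linarith))).le (R.backVert_pos hu' (by linarith)).le
  rw [neg_neg] at this
  exact this.symm

/-- Conversely, the computed parabola is not interrupted: its angular velocity is at most `1 / 50`
and `gTime` is large, so `hitTime_eq` applies. -/
theorem f_inVel (R : Regime g E k) (a : Side) {u x : ℝ} {m : ℤ} (hm : |(m : ℝ)| ≤ 1)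
    (hu : |u| ≤ k / E) (hx : |x| ≤ k / E) (hP : |inVel g E m u x| ≤ √2 * k / √E) :
    f g E (a.center + u, inVel g E m u x) = (a.center + m * π + x, outVel g E m u x) := by
  have hu' : |-u| ≤ k / E := by rwa [abs_neg]
  have hcu := R.cos_ge hu
  have hcx := R.cos_ge hx
  have hg := R.hg
  have hΩ := R.omega_le
  have hw := R.abs_outVel_le hm hu hx
  have e1 : backVel g E (-u) (inVel g E m u x) = outVel g E m u x :=
    backVel_neg_backVel (sqrt_pos.1 (R.vertSpeed_pos (by linarith))).le
      (R.backVert_pos hu (by linarith)).le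
  have hv : vertSpeed g E u (outVel g E m u x) = backVert g E (-u) (inVel g E m u x) := by
    rw [← e1, ← vertSpeed_neg]
    exact vertSpeed_backVel (sqrt_pos.1 (R.vertSpeed_pos (by linarith))).le
      (R.backVert_pos hu' (by linarith)).le
  have hfl := R.flight hm hu hx
  have hτ := R.gTime_ge hm hu hx
  have hs := R.sqrt_ge
  norm_num at hτ
  have hwt : outVel g E m u x * (gTime g E m u x / g) = m * π + x - u := by
    have : gTime g E m u x ≠ 0 := by linarith
    rw [outVel]; field_simp
  have hu2 := R.vertSpeed_sq (u := u) (w := outVel g E m u x) (by linarith)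
  have hx2 := R.vertSpeed_sq (u := x) (w := outVel g E m u x) (by linarith)
  have hangle : a.center + u + outVel g E m u x * (gTime g E m u x / g) =
      a.center + m * π + x := by linarith
  have hT : hitTime g ⟨a.center + u, cos u, outVel g E m u x,
      vertSpeed g E u (outVel g E m u x)⟩ = gTime g E m u x / g := by
    refine hitTime_eq hg (abs_sin_center_add' a u (by linarith)).symm
      (div_pos (by linarith) hg) ?_ ?_
    · simp only [fly]
      rw [hangle, abs_sin_center_add a x (by linarith), ← hfl]
      field_simp
      linear_combination hu2 - hx2
    · rw [mul_div_cancel₀ _ hg.ne']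
      dsimp only
      linarith
  rw [f, returnMap, reflect_collisionState g E a (by linarith), e1, ← hv, hT]
  simp only [fly]
  rw [hangle]

/-- Two flights that end at the same place of the cylinder with the same velocity make the same
number of turns. -/
theorem turns_eq (R : Regime g E k) {a : Side} {u ω x u' : ℝ} {m n : ℤ} (hn : |(n : ℝ)| ≤ 1)
    (hu : |u| ≤ k / E) (hu' : |u'| ≤ k / E) (hω : |ω| ≤ √2 * k / √E) (hx : |x| ≤ k / E)
    (hf : f g E (a.center + u, ω) = (a.center + m * π + x, outVel g E n u' x)) : m = n := by
  obtain ⟨-, t, ht, hδ⟩ := R.landing hu hω hx hf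
  have hg := R.hg
  have hfl := R.flight hn hu' hx
  have hτ := R.gTime_ge hn hu' hx
  have hτ0 := R.gTime_pos hn hu' hx
  have hs := R.sqrt_ge
  have hadv := R.abs_advance_le hn hu' hx
  have hw1 := R.abs_outVel_le hn hu' hx
  have hout : outVel g E n u' x * gTime g E n u' x = g * (n * π + x - u') := by
    rw [outVel, div_mul_cancel₀ _ hτ0.ne']
  norm_num at hτ
  have hw : |outVel g E n u' x| ≤ g := by
    rw [outVel, abs_div, abs_mul, abs_of_pos hg, abs_of_pos hτ0, div_le_iff₀ hτ0]
    gcongr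
    linarith
  rw [← hfl] at hout
  generalize outVel g E n u' x = w at *
  have h1 := R.abs_vertSpeed_sub_le_left hu hu' (w := w) (by linarith)
  -- Both flights have angular velocity `w` and the same landing height, so their durations differ
  -- only through the starting heights. The advances then differ by far less than `π`.
  have h2 : g * ((m - n) * π) =
      w * (vertSpeed g E u w - vertSpeed g E u' w) + g * (u - u') := by
    linear_combination w * ht - g * hδ + hout
  have h3 : |u - u'| ≤ 1 / 1000 := (abs_sub _ _).trans (by linarith [R.kappa_le])
  have h4 : |g * ((m - n) * π)| ≤ g * (1 / 100) := by
    rw [h2]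
    refine (abs_add_le _ _).trans ?_
    rw [abs_mul, abs_mul, abs_of_pos hg]
    calc _ ≤ g * (1 / 1000 / 1000) + g * (1 / 1000) := by
          gcongr
          exact h1.trans (by gcongr)
      _ ≤ _ := by linarith
  rw [abs_mul, abs_mul, abs_of_pos hg, abs_of_pos pi_pos] at h4
  have h5 := le_of_mul_le_mul_left h4 hg
  have h6 : |((m - n : ℤ) : ℝ)| < 1 := by
    push_cast
    nlinarith [pi_gt_three, abs_nonneg ((m : ℝ) - n)]
  have h7 : |m - n| < 1 := by exact_mod_cast h6
  have := Int.abs_lt_one_iff.1 h7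
  linarith

theorem mem_D_iff (R : Regime g E k) (a : Side) (p : ℝ × ℝ) :
    p ∈ D g E k a ↔ |p.1 - a.center| ≤ k / E ∧ |p.2| ≤ √2 * k / √E := by
  refine ⟨fun h => h.2, fun h => ⟨?_, h⟩⟩
  have hc := R.cos_ge h.1
  have h1 := abs_sin_center_add' a (p.1 - a.center) (by linarith)
  rw [add_sub_cancel] at h1
  constructor
  · intro h0
    rw [h0, abs_zero] at h1
    linarith
  · have h2 := R.omega_le
    rw [h1]
    exact sqrt_pos.1 (R.vertSpeed_pos (by linarith [h.2]))

end Regime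

/-! ### Symbols and strips on the cylinder -/

/-- The number of half turns between the two ends of the flights from the source of a symbol to its
rectangle. -/
def Symb.halfTurns : Symb → ℤ
  | .R1 => 1
  | .L2 => 0
  | .R3 => -1
  | .L1 => 1
  | .R2 => 0
  | .L3 => -1

theorem Symb.side_center_eq (s : Symb) :
    s.source.center + s.halfTurns * π = s.side.center + s.turns * (2 * π) := by
  cases s <;> simp only [Symb.source, Symb.halfTurns, Symb.side, Symb.turns, Side.center] <;>
    push_cast <;> ring

theorem Symb.halfTurns_cases (s : Symb) :
    (s.halfTurns : ℝ) = -1 ∨ (s.halfTurns : ℝ) = 0 ∨ (s.halfTurns : ℝ) = 1 := by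
  cases s <;> simp [Symb.halfTurns]

theorem Symb.abs_halfTurns_le (s : Symb) : |(s.halfTurns : ℝ)| ≤ 1 := by
  rcases s.halfTurns_cases with h | h | h <;> simp [h]

theorem canPrecede_iff (s j : Symb) : CanPrecede s j ↔ j.source = s.side := by
  cases s <;> cases j <;> simp [CanPrecede, Symb.source, Symb.side]

theorem proj_eq_iff (p q : ℝ × ℝ) :
    proj p = proj q ↔ (∃ m : ℤ, p.1 = q.1 + m * (2 * π)) ∧ p.2 = q.2 := by
  rw [proj, proj, Prod.mk.injEq, Real.Angle.angle_eq_iff_two_pi_dvd_sub]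
  refine and_congr_left fun _ => exists_congr fun m => ?_
  constructor <;> intro h <;> linarith

/-- The parity of the number of half turns between two centers tells whether the masses agree, even
after the angle is reduced modulo `2 * π`. -/
theorem Side.exists_center_sub (a b : Side) :
    ∃ e : ℤ, b.center = a.center + e * π ∧ (Even e ↔ a = b) := by
  cases a <;> cases b
  · exact ⟨0, by simp, by simp⟩
  · exact ⟨1, by simp only [Side.center]; push_cast; ring, by simp⟩
  · exact ⟨-1, by simp only [Side.center]; push_cast; ring, by simp⟩
  · exact ⟨0, by simp, by simp⟩

namespace Regime

variable {g E k : ℝ}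

theorem proj_injOn (R : Regime g E k) {a b : Side} {p q : ℝ × ℝ} (hp : p ∈ D g E k a)
    (hq : q ∈ D g E k b) (h : proj p = proj q) : a = b ∧ p = q := by
  obtain ⟨⟨m, hm⟩, h2⟩ := (proj_eq_iff p q).1 h
  obtain ⟨e, he, hab⟩ := a.exists_center_sub b
  have h3 := abs_le.1 hp.2.1
  have h4 := abs_le.1 hq.2.1
  have hκ := R.kappa_le
  have h5 : |((e + 2 * m : ℤ) : ℝ)| < 1 := by
    have : |((e + 2 * m : ℤ) : ℝ) * π| < 1 := by
      push_cast
      rw [abs_lt]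
      constructor <;> nlinarith
    rw [abs_mul, abs_of_pos pi_pos] at this
    nlinarith [pi_gt_three, abs_nonneg ((e + 2 * m : ℤ) : ℝ)]
  have h6 : e + 2 * m = 0 := Int.abs_lt_one_iff.1 (by exact_mod_cast h5)
  have h7 : a = b := hab.1 ⟨-m, by omega⟩
  refine ⟨h7, Prod.ext ?_ h2⟩
  subst h7
  have h8 : (e : ℝ) = 0 := by
    have : (e : ℝ) * π = 0 := by linarith
    exact (mul_eq_zero.1 this).resolve_right pi_ne_zero
  have h9 : m = 0 := by
    have : e = 0 := by exact_mod_cast h8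
    omega
  rw [hm, h9]
  simp

theorem center_add_mem_D (R : Regime g E k) (a : Side) {u ω : ℝ} :
    (a.center + u, ω) ∈ D g E k a ↔ |u| ≤ k / E ∧ |ω| ≤ √2 * k / √E := by
  rw [R.mem_D_iff]
  simp

theorem fTilde_inVel (R : Regime g E k) (s : Symb) {u x : ℝ} (hu : |u| ≤ k / E)
    (hx : |x| ≤ k / E) (hP : |inVel g E s.halfTurns u x| ≤ √2 * k / √E) :
    fTilde g E (proj (s.source.center + u, inVel g E s.halfTurns u x)) =
      proj (s.side.center + x, outVel g E s.halfTurns u x) := by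
  rw [fTilde_proj, R.f_inVel _ s.abs_halfTurns_le hu hx hP, proj_eq_iff]
  exact ⟨⟨s.turns, by dsimp only; linarith [s.side_center_eq]⟩, rfl⟩

/-- The mixed coordinates parametrize `H_s`. The landing height needs no separate condition, by the
field `mem` of `IsTwist`. -/
theorem mem_H_iff (R : Regime g E k) (hA : A g E k = 0) (s : Symb) (q : Cylinder) :
    q ∈ H g E k s ↔ ∃ u x, |u| ≤ k / E ∧ |x| ≤ k / E ∧
      |inVel g E s.halfTurns u x| ≤ √2 * k / √E ∧
      q = proj (s.side.center + x, outVel g E s.halfTurns u x) := by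
  constructor
  · rintro ⟨_, ⟨⟨p, hp, rfl⟩, hside⟩, rfl⟩
    obtain ⟨hp1, hp2⟩ := (R.mem_D_iff _ _).1 hp
    obtain ⟨hs1, hs2⟩ := (R.mem_D_iff _ _).1 hside
    dsimp only at hs1 hs2
    set u := p.1 - s.source.center with hu
    set x := (f g E p).1 - s.turns * (2 * π) - s.side.center with hx
    have hpe : p = (s.source.center + u, p.2) := by rw [hu]; ext <;> simp
    have hfe : f g E (s.source.center + u, p.2) =
        (s.source.center + s.halfTurns * π + x, (f g E p).2) := by
      rw [← hpe]
      refine Prod.ext ?_ rfl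
      dsimp only
      rw [s.side_center_eq, hx]
      ring
    obtain ⟨h1, h2⟩ := R.outVel_eq_of_landing hp1 hp2 hs1 hfe
    refine ⟨u, x, hp1, hs1, h1 ▸ hp2, ?_⟩
    rw [← h2, proj_eq_iff]
    exact ⟨⟨s.turns, by dsimp only; rw [hx]; ring⟩, rfl⟩
  · rintro ⟨u, x, hu, hx, hP, rfl⟩
    refine ⟨(s.side.center + s.turns * (2 * π) + x, outVel g E s.halfTurns u x),
      ⟨⟨_, (R.center_add_mem_D _).2 ⟨hu, hP⟩, ?_⟩, ?_⟩, ?_⟩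
    · rw [R.f_inVel _ s.abs_halfTurns_le hu hx hP, s.side_center_eq]
    · have : s.side.center + s.turns * (2 * π) + x - s.turns * (2 * π) = s.side.center + x := by
        ring
      show (s.side.center + s.turns * (2 * π) + x - s.turns * (2 * π), _) ∈ D g E k s.side
      rw [this, R.center_add_mem_D]
      exact ⟨hx, abs_le.2 ((R.isTwist hA s.halfTurns_cases).mem u (abs_le.1 hu) x (abs_le.1 hx)
        (abs_le.1 hP))⟩
    · rw [proj_eq_iff]
      exact ⟨⟨s.turns, by dsimp only; ring⟩, rfl⟩

/-- The points of a rectangle whose images lie in `H_j`. -/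
theorem exists_of_fTilde_mem_H (R : Regime g E k) (hA : A g E k = 0) {a : Side} {p : ℝ × ℝ}
    (hp : p ∈ D g E k a) {j : Symb} (h : fTilde g E (proj p) ∈ H g E k j) :
    j.source = a ∧ ∃ u x, |u| ≤ k / E ∧ |x| ≤ k / E ∧
      |inVel g E j.halfTurns u x| ≤ √2 * k / √E ∧
      p = (a.center + u, inVel g E j.halfTurns u x) := by
  obtain ⟨hp1, hp2⟩ := (R.mem_D_iff _ _).1 hp
  obtain ⟨u', x, hu', hx, hP, he⟩ := (R.mem_H_iff hA j _).1 h
  rw [fTilde_proj, proj_eq_iff] at he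
  obtain ⟨⟨m, hm⟩, h2⟩ := he
  dsimp only at hm h2
  obtain ⟨e, he, hab⟩ := a.exists_center_sub j.source
  set u := p.1 - a.center with hu
  have hpe : p = (a.center + u, p.2) := by rw [hu]; ext <;> simp
  have hside := j.side_center_eq
  have hfe : f g E (a.center + u, p.2) =
      (a.center + ((e + j.halfTurns - 2 * j.turns + 2 * m : ℤ) : ℝ) * π + x,
        outVel g E j.halfTurns u' x) := by
    rw [← hpe]
    refine Prod.ext ?_ h2
    dsimp only
    rw [hm]
    push_cast
    linarith
  have hturn := R.turns_eq j.abs_halfTurns_le hp1 hu' hp2 hx hfe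
  -- Equality of the half turns gives `e = 2 * (j.turns - m)`, which is even.
  have hja : a = j.source := hab.1 ⟨j.turns - m, by omega⟩
  refine ⟨hja.symm, u, x, hp1, hx, ?_⟩
  rw [hturn] at hfe
  obtain ⟨h3, h4⟩ := R.outVel_eq_of_landing hp1 hp2 hx hfe
  refine ⟨h3 ▸ hp2, ?_⟩
  rw [← h3]
  exact hpe

theorem H_subset (R : Regime g E k) (hA : A g E k = 0) {s : Symb} {q : Cylinder}
    (hq : q ∈ H g E k s) : ∃ p ∈ D g E k s.side, q = proj p := by
  obtain ⟨u, x, hu, hx, hP, rfl⟩ := (R.mem_H_iff hA s q).1 hq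
  exact ⟨_, (R.center_add_mem_D _).2 ⟨hx, abs_le.2 ((R.isTwist hA s.halfTurns_cases).mem u
    (abs_le.1 hu) x (abs_le.1 hx) (abs_le.1 hP))⟩, rfl⟩

theorem mem_V_iff (R : Regime g E k) (hA : A g E k = 0) (s : Symb) (q : Cylinder) :
    q ∈ V g E k s ↔ ∃ u x, |u| ≤ k / E ∧ |x| ≤ k / E ∧
      |inVel g E s.halfTurns u x| ≤ √2 * k / √E ∧
      q = proj (s.source.center + u, inVel g E s.halfTurns u x) := by
  constructor
  · rintro ⟨⟨p, hp, rfl⟩, h⟩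
    have key : ∀ a, p ∈ D g E k a → ∃ u x, |u| ≤ k / E ∧ |x| ≤ k / E ∧
        |inVel g E s.halfTurns u x| ≤ √2 * k / √E ∧
        proj p = proj (s.source.center + u, inVel g E s.halfTurns u x) := by
      intro a ha
      obtain ⟨rfl, u, x, hu, hx, hP, rfl⟩ := R.exists_of_fTilde_mem_H hA ha h
      exact ⟨u, x, hu, hx, hP, rfl⟩
    exact hp.elim (key _) (key _)
  · rintro ⟨u, x, hu, hx, hP, rfl⟩
    refine ⟨⟨_, ?_, rfl⟩, ?_⟩
    · have h := (R.center_add_mem_D s.source).2 ⟨hu, hP⟩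
      cases hs : s.source
      · left; rwa [hs] at h
      · right; rwa [hs] at h
    · rw [mem_preimage, R.fTilde_inVel s hu hx hP, R.mem_H_iff hA]
      exact ⟨u, x, hu, hx, hP, rfl⟩

/-! ### Images of horizontal strips and preimages of vertical strips -/

theorem mem_D_of_rect (R : Regime g E k) (a : Side) {p : ℝ × ℝ}
    (h1 : p.1 ∈ Icc (rect E k a).X₀ (rect E k a).X₁)
    (h2 : p.2 ∈ Icc (rect E k a).Y₀ (rect E k a).Y₁) : p ∈ D g E k a := by
  rw [R.mem_D_iff, abs_le, abs_le]
  simp only [rect] at h1 h2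
  exact ⟨⟨by linarith [h1.1], by linarith [h1.2]⟩, h2⟩

theorem horizontal_of_centered {E k μ : ℝ} {a : Side} {h : ℝ → ℝ}
    (hh : IsHorizontalCurve ⟨-(k / E), k / E, -(√2 * k / √E), √2 * k / √E⟩ μ h) :
    IsHorizontalCurve (rect E k a) μ (fun X => h (X - a.center)) := by
  have hI : ∀ X ∈ Icc (rect E k a).X₀ (rect E k a).X₁, X - a.center ∈ Icc (-(k / E)) (k / E) := by
    intro X hX
    simp only [rect] at hX
    exact ⟨by linarith [hX.1], by linarith [hX.2]⟩
  refine ⟨fun X hX => hh.1 _ (hI X hX), fun X hX X' hX' => ?_⟩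
  have := hh.2 _ (hI X hX) _ (hI X' hX')
  rwa [sub_sub_sub_cancel_right] at this

theorem centered_of_horizontal {E k μ : ℝ} {a : Side} {h : ℝ → ℝ}
    (hh : IsHorizontalCurve (rect E k a) μ h) :
    IsHorizontalCurve ⟨-(k / E), k / E, -(√2 * k / √E), √2 * k / √E⟩ μ
      (fun u => h (a.center + u)) := by
  have hI : ∀ u ∈ Icc (-(k / E)) (k / E),
      a.center + u ∈ Icc (rect E k a).X₀ (rect E k a).X₁ := by
    intro u hu
    exact ⟨by simp only [rect]; linarith [hu.1], by simp only [rect]; linarith [hu.2]⟩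
  refine ⟨fun u hu => hh.1 _ (hI u hu), fun u hu u' hu' => ?_⟩
  have := hh.2 _ (hI u hu) _ (hI u' hu')
  rwa [add_sub_add_left_eq_sub] at this

theorem vertical_of_centered {E k μ : ℝ} {a : Side} {v : ℝ → ℝ}
    (hv : IsVerticalCurve ⟨-(k / E), k / E, -(√2 * k / √E), √2 * k / √E⟩ μ v) :
    IsVerticalCurve (rect E k a) μ (fun Y => a.center + v Y) := by
  refine ⟨fun Y hY => ?_, fun Y hY Y' hY' => ?_⟩
  · have := hv.1 Y hY
    exact ⟨by simp only [rect]; linarith [this.1], by simp only [rect]; linarith [this.2]⟩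
  · rw [add_sub_add_left_eq_sub]
    exact hv.2 Y hY Y' hY'

theorem centered_of_vertical {E k μ : ℝ} {a : Side} {v : ℝ → ℝ}
    (hv : IsVerticalCurve (rect E k a) μ v) :
    IsVerticalCurve ⟨-(k / E), k / E, -(√2 * k / √E), √2 * k / √E⟩ μ
      (fun Y => v Y - a.center) := by
  refine ⟨fun Y hY => ?_, fun Y hY Y' hY' => ?_⟩
  · have := hv.1 Y hY
    simp only [rect] at this
    exact ⟨by dsimp only; linarith [this.1], by dsimp only; linarith [this.2]⟩
  · rw [sub_sub_sub_cancel_right]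
    exact hv.2 Y hY Y' hY'

theorem horizontal_image (R : Regime g E k) (hA : A g E k = 0) {a : Side} {S : Set Cylinder}
    {d : ℝ} (hS : IsHorizontalStrip (rect E k a) ((g + 1) / √E) S d) {j : Symb}
    (hj : j.source = a) : ∃ d' < d, IsHorizontalStrip (rect E k j.side) ((g + 1) / √E)
      (fTilde g E '' S ∩ H g E k j) d' := by
  obtain ⟨h₁, h₂, hh₁, hh₂, hlt, hSe, hd⟩ := hS
  subst hj
  have hr := R.sqrt_pos'
  have hr1 := R.sqrt_ge
  have hrr := R.sq_sqrt'
  have hg := R.hg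
  have hgr := R.g_le_sqrt
  have hμ : 0 ≤ (g + 1) / √E := by positivity
  have hμ1 : (g + 1) / √E ≤ √E / 2 := by rw [div_le_iff₀ hr]; nlinarith
  have hb1 : g / √E ≤ √E / 2 := le_trans (by gcongr; linarith) hμ1
  have hcb : g / (2 * √E) = g / √E / 2 := by field_simp
  have hI : ∀ u ∈ Icc (-(k / E)) (k / E),
      j.source.center + u ∈ Icc (rect E k j.source).X₀ (rect E k j.source).X₁ := by
    intro u hu
    exact ⟨by simp only [rect]; linarith [hu.1], by simp only [rect]; linarith [hu.2]⟩
  obtain ⟨h₁', h₂', k₁, k₂, k₃, k₄, k₅⟩ := (R.isTwist hA j.halfTurns_cases).horizontal hμ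
    (by linarith) (by positivity)
    -- The image has Lipschitz constant at most `c * (1 + b / (a - μ)) ≤ 2 * c = g / √E`, because `b
    -- ≤ a - μ`.
    (by
      have e1 : g / (2 * √E) * (g / √E + (2 * √E - (g + 1) / √E)) ≤
          g / (2 * √E) * (2 * (2 * √E - (g + 1) / √E)) := by gcongr; linarith
      have e2 : g / √E * (2 * √E - (g + 1) / √E) ≤
          (g + 1) / √E * (2 * √E - (g + 1) / √E) := by
        gcongr
        · linarith
        · linarith
      rw [hcb] at e1 ⊢
      linarith)
    (by rw [hcb]; linarith [div_pos hg hr])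
    (centered_of_horizontal hh₁) (centered_of_horizontal hh₂)
    (fun X hX => hlt _ (hI X hX)) (d := d) (fun X hX => hd.2 ⟨_, hI X hX, rfl⟩)
  have hX : (rect E k j.side).X₀ ≤ (rect E k j.side).X₁ := by
    simp only [rect]; linarith [R.kappa_pos]
  have c₁ := horizontal_of_centered (a := j.side) k₁
  have c₂ := horizontal_of_centered (a := j.side) k₂
  have hI' : ∀ X ∈ Icc (rect E k j.side).X₀ (rect E k j.side).X₁,
      X - j.side.center ∈ Icc (-(k / E)) (k / E) := by
    intro X hX
    simp only [rect] at hX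
    exact ⟨by linarith [hX.1], by linarith [hX.2]⟩
  obtain ⟨d', hd'⟩ := exists_isGreatest_width hμ hX c₁.2 c₂.2
  refine ⟨d', ?_, _, _, c₁, c₂, fun X hX => k₃ _ (hI' X hX), ?_, hd'⟩
  · obtain ⟨X, hX, rfl⟩ := hd'.1
    exact k₅ _ (hI' X hX)
  · ext q
    constructor
    · rintro ⟨⟨q, hq, rfl⟩, hqj⟩
      rw [hSe] at hq
      obtain ⟨p, ⟨hp1, hp2⟩, rfl⟩ := hq
      have hpD : p ∈ D g E k j.source := R.mem_D_of_rect _ hp1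
        ⟨(hh₁.1 _ hp1).1.trans hp2.1, hp2.2.trans (hh₂.1 _ hp1).2⟩
      obtain ⟨-, u, x, hu, hx, hP, rfl⟩ := R.exists_of_fTilde_mem_H hA hpD hqj
      rw [R.fTilde_inVel j hu hx hP]
      refine ⟨_, ⟨?_, ?_⟩, rfl⟩
      · have := abs_le.1 hx
        exact ⟨by simp only [rect]; linarith, by simp only [rect]; linarith⟩
      · dsimp only
        rw [add_sub_cancel_left]
        exact (k₄ x (abs_le.1 hx) _).2 ⟨u, abs_le.1 hu, hp2, rfl⟩
    · rintro ⟨⟨X, y⟩, ⟨hX, hy⟩, rfl⟩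
      obtain ⟨u, hu, hP, hy'⟩ := (k₄ _ (hI' X hX) y).1 hy
      dsimp only at hP hX
      have hP' : |inVel g E j.halfTurns u (X - j.side.center)| ≤ √2 * k / √E :=
        abs_le.2 ⟨(hh₁.1 _ (hI u hu)).1.trans hP.1, hP.2.trans (hh₂.1 _ (hI u hu)).2⟩
      have he := R.fTilde_inVel j (abs_le.2 hu) (abs_le.2 (hI' X hX)) hP'
      rw [add_sub_cancel, ← hy'] at he
      refine ⟨⟨_, ?_, he⟩, ?_⟩
      · rw [hSe]
        exact ⟨_, ⟨hI u hu, hP⟩, rfl⟩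
      · rw [R.mem_H_iff hA]
        refine ⟨u, X - j.side.center, abs_le.2 hu, abs_le.2 (hI' X hX), hP', ?_⟩
        rw [add_sub_cancel, ← hy']

theorem horizontal_image_empty (R : Regime g E k) (hA : A g E k = 0) {a : Side} {S : Set Cylinder}
    {μ d : ℝ} (hS : IsHorizontalStrip (rect E k a) μ S d) {j : Symb}
    (hj : j.source ≠ a) : fTilde g E '' S ∩ H g E k j = ∅ := by
  obtain ⟨h₁, h₂, hh₁, hh₂, hlt, hSe, hd⟩ := hS
  rw [eq_empty_iff_forall_notMem]
  rintro _ ⟨⟨q, hq, rfl⟩, hqj⟩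
  rw [hSe] at hq
  obtain ⟨p, ⟨hp1, hp2⟩, rfl⟩ := hq
  have hpD : p ∈ D g E k a := R.mem_D_of_rect _ hp1
    ⟨(hh₁.1 _ hp1).1.trans hp2.1, hp2.2.trans (hh₂.1 _ hp1).2⟩
  exact hj (R.exists_of_fTilde_mem_H hA hpD hqj).1

theorem vertical_preimage (R : Regime g E k) (hA : A g E k = 0) {a : Side} {S : Set Cylinder}
    {d : ℝ} (hS : IsVerticalStrip (rect E k a) ((g + 1) / √E) S d) {j : Symb}
    (hj : j.side = a) : ∃ d' < d, IsVerticalStrip (rect E k j.source) ((g + 1) / √E)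
      (fTilde g E ⁻¹' S ∩ V g E k j) d' := by
  obtain ⟨v₁, v₂, hv₁, hv₂, hlt, hSe, hd⟩ := hS
  subst hj
  have hr := R.sqrt_pos'
  have hr1 := R.sqrt_ge
  have hrr := R.sq_sqrt'
  have hg := R.hg
  have hgr := R.g_le_sqrt
  have hμ : 0 ≤ (g + 1) / √E := by positivity
  have hb1 : g / √E ≤ 1 := by rw [div_le_iff₀ hr]; linarith
  have hμ1 : (g + 1) / √E ≤ 1 / 8 := by rw [div_le_iff₀ hr]; linarith
  have hcb : g / (2 * √E) = g / √E / 2 := by field_simp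
  have hb0 : 0 < g / √E := by positivity
  have hμc : (g + 1) / √E * (g / (2 * √E)) ≤ 1 / 8 := by
    rw [hcb]
    nlinarith
  have hΩ := R.omega_pos
  have hbc : 2 * (g / √E) * ((g + 1) / √E * (g / (2 * √E))) ≤ 2 * 1 * (1 / 8) := by gcongr
  obtain ⟨v₁', v₂', k₁, k₂, k₃, k₄, k₅⟩ := (R.isTwist hA j.halfTurns_cases).vertical hμ
    (by positivity) (by positivity) (by positivity) (by linarith) (by linarith)
    -- The preimage has Lipschitz constant at most `1 / √E`. This is why the constant is `g + 1`: it
    -- must dominate both `g` and `1`.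
    (by
      have e1 : (g + 1) / √E * √E ≤ (g + 1) / √E *
          (2 * √E - 2 * (g / √E) * ((g + 1) / √E * (g / (2 * √E)))) := by
        gcongr; linarith
      rw [div_mul_cancel₀ _ hr.ne'] at e1
      linarith)
    (centered_of_vertical hv₁) (centered_of_vertical hv₂)
    (fun Y hY => sub_lt_sub_right (hlt Y hY) _) (d := d)
    (fun Y hY => by rw [sub_sub_sub_cancel_right]; exact hd.2 ⟨_, hY, rfl⟩)
  have hY : (rect E k j.source).Y₀ ≤ (rect E k j.source).Y₁ := by
    simp only [rect]; linarith
  have c₁ := vertical_of_centered (a := j.source) k₁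
  have c₂ := vertical_of_centered (a := j.source) k₂
  obtain ⟨d', hd'⟩ := exists_isGreatest_width hμ hY c₁.2 c₂.2
  have hcoord : ∀ {x w : ℝ}, |x| ≤ k / E → |w| ≤ √2 * k / √E →
      (proj (j.side.center + x, w) ∈ S ↔
        x ∈ Icc (v₁ w - j.side.center) (v₂ w - j.side.center)) := by
    intro x w hx hw
    rw [hSe]
    constructor
    · rintro ⟨p, ⟨hp2, hp1⟩, he⟩
      have hpD : p ∈ D g E k j.side := R.mem_D_of_rect _
        ⟨(hv₁.1 _ hp2).1.trans hp1.1, hp1.2.trans (hv₂.1 _ hp2).2⟩ hp2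
      obtain ⟨-, rfl⟩ := R.proj_injOn hpD ((R.center_add_mem_D _).2 ⟨hx, hw⟩) he
      dsimp only at hp1
      exact ⟨by linarith [hp1.1], by linarith [hp1.2]⟩
    · intro h
      exact ⟨_, ⟨abs_le.1 hw, by dsimp only; exact ⟨by linarith [h.1], by linarith [h.2]⟩⟩, rfl⟩
  have hW : ∀ {u x : ℝ}, |u| ≤ k / E → |x| ≤ k / E →
      |inVel g E j.halfTurns u x| ≤ √2 * k / √E → |outVel g E j.halfTurns u x| ≤ √2 * k / √E :=
    fun {u x} hu hx hP => abs_le.2 ((R.isTwist hA j.halfTurns_cases).mem u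
      (abs_le.1 hu) x (abs_le.1 hx) (abs_le.1 hP))
  refine ⟨d', ?_, _, _, c₁, c₂, fun Y hY => ?_, ?_, hd'⟩
  · obtain ⟨Y, hY, rfl⟩ := hd'.1
    dsimp only
    rw [add_sub_add_left_eq_sub]
    exact k₅ _ hY
  · linarith [k₃ Y hY]
  · ext q
    constructor
    · rintro ⟨hqS, hqV⟩
      obtain ⟨u, x, hu, hx, hP, rfl⟩ := (R.mem_V_iff hA j q).1 hqV
      rw [mem_preimage, R.fTilde_inVel j hu hx hP, hcoord hx (hW hu hx hP)] at hqS
      refine ⟨_, ⟨abs_le.1 hP, ?_⟩, rfl⟩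
      have := (k₄ _ (abs_le.1 hP) u).2 ⟨abs_le.1 hu, x, abs_le.1 hx, hqS, rfl⟩
      exact ⟨by dsimp only; linarith [this.1], by dsimp only; linarith [this.2]⟩
    · rintro ⟨⟨X, y⟩, ⟨hy, hX⟩, rfl⟩
      dsimp only at hX hy
      obtain ⟨hu, x, hx, hxv, hP⟩ := (k₄ y hy (X - j.source.center)).1
        ⟨by linarith [hX.1], by linarith [hX.2]⟩
      have hP' : |inVel g E j.halfTurns (X - j.source.center) x| ≤ √2 * k / √E :=
        hP ▸ abs_le.2 hy
      have he := R.fTilde_inVel j (abs_le.2 hu) (abs_le.2 hx) hP'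
      have hq : ((X, y) : ℝ × ℝ) = (j.source.center + (X - j.source.center),
          inVel g E j.halfTurns (X - j.source.center) x) := by rw [add_sub_cancel, ← hP]
      rw [hq]
      refine ⟨?_, (R.mem_V_iff hA j _).2 ⟨_, x, abs_le.2 hu, abs_le.2 hx, hP', rfl⟩⟩
      rw [mem_preimage, he, hcoord (abs_le.2 hx) (hW (abs_le.2 hu) (abs_le.2 hx) hP')]
      exact hxv

theorem vertical_preimage_empty (R : Regime g E k) (hA : A g E k = 0) {a : Side} {S : Set Cylinder}
    {μ d : ℝ} (hS : IsVerticalStrip (rect E k a) μ S d) {j : Symb}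
    (hj : j.side ≠ a) : fTilde g E ⁻¹' S ∩ V g E k j = ∅ := by
  obtain ⟨v₁, v₂, hv₁, hv₂, hlt, hSe, hd⟩ := hS
  rw [eq_empty_iff_forall_notMem]
  rintro q ⟨hqS, hqV⟩
  obtain ⟨p', hp', he⟩ := R.H_subset hA hqV.2
  rw [mem_preimage, he, hSe] at hqS
  obtain ⟨p, ⟨hp2, hp1⟩, he'⟩ := hqS
  have hpD : p ∈ D g E k a := R.mem_D_of_rect _
    ⟨(hv₁.1 _ hp2).1.trans hp1.1, hp1.2.trans (hv₂.1 _ hp2).2⟩ hp2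
  exact hj (R.proj_injOn hp' hpD he'.symm).1

theorem mem_rect_of_D (R : Regime g E k) (a : Side) {p : ℝ × ℝ} (hp : p ∈ D g E k a) :
    p.1 ∈ Icc (rect E k a).X₀ (rect E k a).X₁ ∧ p.2 ∈ Icc (rect E k a).Y₀ (rect E k a).Y₁ := by
  obtain ⟨h1, h2⟩ := (R.mem_D_iff _ _).1 hp
  have h1 := abs_le.1 h1
  exact ⟨⟨by simp only [rect]; linarith, by simp only [rect]; linarith⟩, abs_le.1 h2⟩

theorem isHorizontalStrip_D (R : Regime g E k) (a : Side) {μ : ℝ} (hμ : 0 ≤ μ) :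
    ∃ d, IsHorizontalStrip (rect E k a) μ (proj '' D g E k a) d := by
  have hΩ := R.omega_pos
  have c : ∀ y ∈ Icc (rect E k a).Y₀ (rect E k a).Y₁, IsHorizontalCurve (rect E k a) μ fun _ => y :=
    fun y hy => ⟨fun _ _ => hy, fun _ _ _ _ => by simp only [sub_self, abs_zero]; positivity⟩
  have c₁ := c (rect E k a).Y₀ ⟨le_rfl, by simp only [rect]; linarith⟩
  have c₂ := c (rect E k a).Y₁ ⟨by simp only [rect]; linarith, le_rfl⟩
  obtain ⟨d, hd⟩ := exists_isGreatest_width hμ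
    (by simp only [rect]; linarith [R.kappa_pos]) c₁.2 c₂.2
  refine ⟨d, _, _, c₁, c₂, fun _ _ => by simp only [rect]; linarith, ?_, hd⟩
  congr 1
  ext p
  exact ⟨R.mem_rect_of_D a, fun h => R.mem_D_of_rect a h.1 h.2⟩

theorem isVerticalStrip_D (R : Regime g E k) (a : Side) {μ : ℝ} (hμ : 0 ≤ μ) :
    ∃ d, IsVerticalStrip (rect E k a) μ (proj '' D g E k a) d := by
  have hκ := R.kappa_pos
  have c : ∀ y ∈ Icc (rect E k a).X₀ (rect E k a).X₁, IsVerticalCurve (rect E k a) μ fun _ => y :=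
    fun y hy => ⟨fun _ _ => hy, fun _ _ _ _ => by simp only [sub_self, abs_zero]; positivity⟩
  have c₁ := c (rect E k a).X₀ ⟨le_rfl, by simp only [rect]; linarith⟩
  have c₂ := c (rect E k a).X₁ ⟨by simp only [rect]; linarith, le_rfl⟩
  obtain ⟨d, hd⟩ := exists_isGreatest_width hμ
    (by simp only [rect]; linarith [R.omega_pos]) c₁.2 c₂.2
  refine ⟨d, _, _, c₁, c₂, fun _ _ => by simp only [rect]; linarith, ?_, hd⟩
  congr 1
  ext p
  exact ⟨fun h => (R.mem_rect_of_D a h).symm, fun h => R.mem_D_of_rect a h.2 h.1⟩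

/-- The whole source rectangle is itself a horizontal strip, and `H_s` is contained in its image; so
this is an instance of `horizontal_image`. -/
theorem H_isStrip (R : Regime g E k) (hA : A g E k = 0) (s : Symb) :
    ∃ d, IsHorizontalStrip (rect E k s.side) ((g + 1) / √E) (H g E k s) d := by
  obtain ⟨d, hd⟩ := R.isHorizontalStrip_D s.source (μ := (g + 1) / √E)
    (by have := R.hg; positivity)
  obtain ⟨d', -, hd'⟩ := R.horizontal_image hA hd rfl
  refine ⟨d', ?_⟩
  rwa [inter_eq_self_of_subset_right] at hd'
  intro q hq
  obtain ⟨u, x, hu, hx, hP, rfl⟩ := (R.mem_H_iff hA s q).1 hq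
  exact ⟨_, mem_image_of_mem _ ((R.center_add_mem_D _).2 ⟨hu, hP⟩), R.fTilde_inVel s hu hx hP⟩

theorem V_isStrip (R : Regime g E k) (hA : A g E k = 0) (s : Symb) :
    ∃ d, IsVerticalStrip (rect E k s.source) ((g + 1) / √E) (V g E k s) d := by
  obtain ⟨d, hd⟩ := R.isVerticalStrip_D s.side (μ := (g + 1) / √E)
    (by have := R.hg; positivity)
  obtain ⟨d', -, hd'⟩ := R.vertical_preimage hA hd rfl
  refine ⟨d', ?_⟩
  rwa [inter_eq_self_of_subset_right] at hd'
  intro q hq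
  obtain ⟨p, hp, he⟩ := R.H_subset hA hq.2
  exact ⟨p, hp, he.symm⟩

end Regime

end CoinBilliard

end

/-! ### The proposition -/

theorem proposition5p3 (g : ℝ) (hg : 0 < g) (k₁ k₂ : ℝ) (hk₁ : 0 < k₁) (hk₂ : k₁ < k₂) :
    ∃ C : ℝ, 0 < C ∧ ∃ E₀ : ℝ, 0 < E₀ ∧ ∀ E : ℝ, E₀ ≤ E → ∀ k : ℝ, k₁ < k → k < k₂ →
      CoinBilliard.A g E k = 0 →
      -- the `H_s` are horizontal strips and the `V_s` are vertical strips
      (∀ s : Symb, ∃ d, IsHorizontalStrip (rect E k s.side) (C / √E) (H g E k s) d) ∧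
      (∀ s : Symb, ∃ d, IsVerticalStrip (rect E k s.source) (C / √E) (V g E k s) d) ∧
      -- images of the `H_s`
      (∀ s j : Symb, CanPrecede s j →
        ∀ d, IsHorizontalStrip (rect E k s.side) (C / √E) (H g E k s) d →
          ∃ d' < d, IsHorizontalStrip (rect E k j.side) (C / √E)
            (fTilde g E '' H g E k s ∩ H g E k j) d') ∧
      (∀ s j : Symb, ¬ CanPrecede s j → fTilde g E '' H g E k s ∩ H g E k j = ∅) ∧
      -- preimages of the `V_s`
      (∀ s j : Symb, CanPrecede j s →
        ∀ d, IsVerticalStrip (rect E k s.source) (C / √E) (V g E k s) d →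
          ∃ d' < d, IsVerticalStrip (rect E k j.source) (C / √E)
            (fTilde g E ⁻¹' V g E k s ∩ V g E k j) d') ∧
      (∀ s j : Symb, ¬ CanPrecede j s → fTilde g E ⁻¹' V g E k s ∩ V g E k j = ∅) ∧
      -- the third Conley-Moser condition, for arbitrary horizontal strips
      (∀ (a : Side) (S : Set Cylinder) (d : ℝ),
        IsHorizontalStrip (rect E k a) (C / √E) S d → S ⊆ ⋃ s, H g E k s →
          ∀ j : Symb,
            (j.source = a → ∃ d' < d, IsHorizontalStrip (rect E k j.side) (C / √E)
              (fTilde g E '' S ∩ H g E k j) d') ∧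
            (j.source ≠ a → fTilde g E '' S ∩ H g E k j = ∅)) ∧
      -- the third Conley-Moser condition, for arbitrary vertical strips
      (∀ (a : Side) (S : Set Cylinder) (d : ℝ),
        IsVerticalStrip (rect E k a) (C / √E) S d → S ⊆ ⋃ s, V g E k s →
          ∀ j : Symb,
            (j.side = a → ∃ d' < d, IsVerticalStrip (rect E k j.source) (C / √E)
              (fTilde g E ⁻¹' S ∩ V g E k j) d') ∧
            (j.side ≠ a → fTilde g E ⁻¹' S ∩ V g E k j = ∅)) := by
  have hk₂0 : 0 < k₂ := by linarith
  -- The threshold is formed with the upper bound `k₂`, so that both inequalities of `Regime` hold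
  -- for all admissible `k` at once.
  refine ⟨g + 1, by linarith, 10000 * ((1 + g) ^ 2 * (1 + k₂) ^ 2) + 10000 * k₂ ^ 2 / g, by
    positivity, fun E hE k h1 h2 hA => ?_⟩
  have R : Regime g E k := by
    have hp : 0 ≤ 10000 * ((1 + g) ^ 2 * (1 + k₂) ^ 2) := by positivity
    have hq : 0 ≤ 10000 * k₂ ^ 2 / g := by positivity
    have hk : 0 < k := by linarith
    refine ⟨hg, hk, ?_, ?_⟩
    · have : 10000 * ((1 + g) ^ 2 * (1 + k) ^ 2) ≤ 10000 * ((1 + g) ^ 2 * (1 + k₂) ^ 2) := by gcongr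
      linarith
    · have h3 : 10000 * k₂ ^ 2 / g ≤ E := by linarith
      rw [div_le_iff₀ hg] at h3
      have : 10000 * k ^ 2 ≤ 10000 * k₂ ^ 2 := by gcongr
      linarith
  refine ⟨R.H_isStrip hA, R.V_isStrip hA, ?_, ?_, ?_, ?_, ?_, ?_⟩
  · intro s j h d hd
    exact R.horizontal_image hA hd ((canPrecede_iff s j).1 h)
  · intro s j h
    obtain ⟨d, hd⟩ := R.H_isStrip hA s
    exact R.horizontal_image_empty hA hd (fun e => h ((canPrecede_iff s j).2 e))
  · intro s j h d hd
    exact R.vertical_preimage hA hd ((canPrecede_iff j s).1 h).symm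
  · intro s j h
    obtain ⟨d, hd⟩ := R.V_isStrip hA s
    exact R.vertical_preimage_empty hA hd (fun e => h ((canPrecede_iff j s).2 e.symm))
  · intro a S d hd _ j
    exact ⟨R.horizontal_image hA hd, R.horizontal_image_empty hA hd⟩
  · intro a S d hd _ j
    exact ⟨R.vertical_preimage hA hd, R.vertical_preimage_empty hA hd⟩
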